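/- Fix $0<\delta<1$ and $1/2\le\sigma<1$. For $t>1$ let $\lambda_c=\dfrac{t^{\delta-1}}{1-t^{\delta-1}}$, let $\lambda=\lambda_c(1+\Lambda)$, and suppose that $\lambda$ lies in the range $$\lambda_c\le\lambda\le t^{1-\delta}-1 .$$ Let the angle $\phi$ satisfy $0<\phi<\pi/2$ if $\ln\lambda\ge0$, and $0<\phi<\arctan(\pi/|\ln\lambda|)$ if $\ln\lambda<0$. With principal branches of all logarithms and powers, and with contours that are the rays in the indicated direction, let $$J_B(t;\lambda)=\int_{1-t^{\delta-1}}^{\infty e^{i\phi}}(1-z)^{-1/2}z^{\sigma-1/2}\exp\big(it[(1-z)\ln(1-z)+z\ln z+z\ln\lambda]\big)\,dz,$$ $$\widetilde J_B(t;\Lambda)=\int_0^{\infty e^{i\phi}}(1-\zeta)^{-1/2}(1+\lambda_c\zeta)^{\sigma-1/2}\exp\Big(\frac{it f_1(\zeta)}{1+\lambda_c}\Big)\,d\zeta,$$ where $$f_1(\zeta)=\lambda_c\zeta\big[\ln(1+\Lambda)+\ln(1+\lambda_c\zeta)-\ln(1-\zeta)\big]+\ln(1+\lambda_c\zeta)+\lambda_c\ln(1-\zeta).$$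 Let $f_0=\ln\dfrac{\lambda_c(1+\Lambda)}{1+\lambda_c}-\lambda_c\ln\dfrac{1+\lambda_c}{\lambda_c}$ and $\omega=\omega(t,\Lambda)=\sqrt{\dfrac{\lambda_c t}{2}}\,\dfrac{\ln(1+\Lambda)}{1+\lambda_c}$. Theorem 1. For all such $t,\Lambda,\phi$ the integrals $J_B$ and $\widetilde J_B$ converge absolutely, as does $\int_w^{\infty e^{i\pi/4}}e^{i\xi^2}d\xi$ for every $w\ge0$. Moreover $\omega\ge 0$, and $$J_B(t;\lambda)=\Big(\frac{\lambda_c}{1+\lambda_c}\Big)^{1/2}\Big(\frac1{1+\lambda_c}\Big)^{\sigma-1/2}\exp\Big(\frac{it f_0}{1+\lambda_c}\Big)\,\widetilde J_B(t;\Lambda).$$ As $t\to\infty$, $$\widetilde J_B(t;\Lambda)=e^{-i\omega^2}\sqrt{\frac{2}{\lambda_c t}}\Big(\int_\omega^{\infty e^{i\pi/4}}e^{i\xi^2}\,d\xi\Big)\,(1+o(1)),$$ where the $o(1)$ is uniform in $\Lambda$ over the whole range (and in $\phi$). Inserting this in the preceding relation gives the leading-order asymptotics of $J_B$, with the same uniformity.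 The integral $\int_\omega^{\infty e^{i\pi/4}}e^{i\xi^2}d\xi$ is bounded uniformly in $t$ and $\Lambda$; in particular it is $O(1)$ when $\omega=O(1)$. There are constants $C$ and $W>0$, independent of $t$ and $\Lambda$, such that whenever $\omega\ge W$ $$\Big|e^{-i\omega^2}\int_\omega^{\infty e^{i\pi/4}}e^{i\xi^2}\,d\xi+\frac{1}{2i\omega}\Big|\le\frac{C}{\omega^3},$$ and, as $t\to\infty$, $$\widetilde J_B(t;\Lambda)=\sqrt{\frac{2}{\lambda_c t}}\Big(-\frac1{2i\omega}+r\Big)(1+o(1)),\qquad |r|\le\frac{C}{\omega^{3}},$$ where the $o(1)$ is uniform in $\phi$ and in all $\Lambda$ of the range with $\omega\ge W$. In particular this holds along every choice of $\Lambda=\Lambda(t)$ with $\omega\to\infty$. -/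

import Mathlib

noncomputable section

namespace UniformJB

open Set

/-- The point `a + r e^{iφ}` at distance `r` from `a` on the ray of direction `φ`. -/
def rayPoint (a : ℂ) (φ r : ℝ) : ℂ := a + (r : ℂ) * Complex.exp (Complex.I * (φ : ℂ))

/-- The contour integral `∫_a^{∞ e^{iφ}} f(z) dz`, taken along the ray from `a` of direction `φ`. -/
def rayIntegral (f : ℂ → ℂ) (a : ℂ) (φ : ℝ) : ℂ :=
  ∫ r in Ioi (0 : ℝ), f (rayPoint a φ r) * Complex.exp (Complex.I * (φ : ℂ))

/-- Absolute convergence of `∫_a^{∞ e^{iφ}} f(z) dz` along the ray from `a` of direction `φ`. -/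
def RayIntegrable (f : ℂ → ℂ) (a : ℂ) (φ : ℝ) : Prop :=
  MeasureTheory.IntegrableOn
    (fun r : ℝ => f (rayPoint a φ r) * Complex.exp (Complex.I * (φ : ℂ))) (Ioi (0 : ℝ))

/-- `λ_c = t^{δ-1} / (1 - t^{δ-1})`. -/
def lamC (δ t : ℝ) : ℝ := t ^ (δ - 1) / (1 - t ^ (δ - 1))

/-- The admissible values of `λ`: `λ_c ≤ λ ≤ t^{1-δ} - 1`. -/
def lamRange (δ t : ℝ) : Set ℝ := Icc (lamC δ t) (t ^ (1 - δ) - 1)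

/-- The admissible directions `φ` of the contour of integration. -/
def AdmissibleAngle (lam φ : ℝ) : Prop :=
  (0 ≤ Real.log lam ∧ 0 < φ ∧ φ < Real.pi / 2) ∨
  (Real.log lam < 0 ∧ 0 < φ ∧ φ < Real.arctan (Real.pi / |Real.log lam|))

/-- `F(z; λ) = (1-z) ln(1-z) + z ln z + z ln λ`, with principal logarithms. -/
def phaseF (lam : ℝ) (z : ℂ) : ℂ :=
  (1 - z) * Complex.log (1 - z) + z * Complex.log z + z * (Real.log lam : ℂ)

/-- The integrand `(1-z)^{-1/2} z^{σ-1/2} exp(i t F(z; λ))` of `J_B`. -/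
def integrandJB (σ t lam : ℝ) (z : ℂ) : ℂ :=
  (1 - z) ^ (-(1 / 2) : ℂ) * z ^ ((σ : ℂ) - 1 / 2) *
    Complex.exp (Complex.I * (t : ℂ) * phaseF lam z)

/-- `J_B(t; λ)`, computed along the ray of direction `φ` that starts at `1 - t^{δ-1}`. -/
def JB (δ σ t lam φ : ℝ) : ℂ :=
  rayIntegral (integrandJB σ t lam) ((1 - t ^ (δ - 1) : ℝ) : ℂ) φ

/-- `f_0(Λ, λ_c)`. -/
def f0 (Lam lc : ℝ) : ℝ :=
  Real.log (lc * (1 + Lam) / (1 + lc)) - lc * Real.log ((1 + lc) / lc)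

/-- `f_1(ζ; t, Λ)`, as a function of `ζ`, `Λ` and `lc = λ_c`. -/
def f1 (lc Lam : ℝ) (ζ : ℂ) : ℂ :=
  (lc : ℂ) * ζ * ((Real.log (1 + Lam) : ℂ) + Complex.log (1 + (lc : ℂ) * ζ) - Complex.log (1 - ζ))
    + Complex.log (1 + (lc : ℂ) * ζ) + (lc : ℂ) * Complex.log (1 - ζ)

/-- `h(ζ; t, Λ) = f_1(ζ; t, Λ) / (1 + λ_c)`. -/
def phaseH (δ t Lam : ℝ) (ζ : ℂ) : ℂ := f1 (lamC δ t) Lam ζ / (1 + (lamC δ t : ℂ))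

/-- `g(ζ; t) = (1-ζ)^{-1/2} (1 + λ_c ζ)^{σ-1/2}`. -/
def ampG (δ σ t : ℝ) (ζ : ℂ) : ℂ :=
  (1 - ζ) ^ (-(1 / 2) : ℂ) * (1 + (lamC δ t : ℂ) * ζ) ^ ((σ : ℂ) - 1 / 2)

/-- The integrand `g(ζ; t) exp(i t h(ζ; t, Λ))` of the reduced integral. -/
def integrandTilde (δ σ t Lam : ℝ) (ζ : ℂ) : ℂ :=
  ampG δ σ t ζ * Complex.exp (Complex.I * (t : ℂ) * phaseH δ t Lam ζ)

/-- The reduced integral `J̃_B(t; Λ)`, computed along the ray of direction `φ` from `0`. -/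
def JBtilde (δ σ t Lam φ : ℝ) : ℂ := rayIntegral (integrandTilde δ σ t Lam) 0 φ

/-- The explicit factor that relates `J_B` to `J̃_B`. -/
def prefactor (δ σ t Lam : ℝ) : ℂ :=
  (((lamC δ t / (1 + lamC δ t)) ^ (1 / 2 : ℝ) * (1 / (1 + lamC δ t)) ^ (σ - 1 / 2) : ℝ) : ℂ) *
    Complex.exp (Complex.I * (t : ℂ) * (f0 Lam (lamC δ t) : ℂ) / (1 + (lamC δ t : ℂ)))

/-- `ω(t, Λ) = √(λ_c t / 2) · ln(1+Λ) / (1+λ_c)`. -/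
def omega (δ t Lam : ℝ) : ℝ :=
  Real.sqrt (lamC δ t * t / 2) * (Real.log (1 + Lam) / (1 + lamC δ t))

/-- The integrand `e^{iξ²}`. -/
def fresnelIntegrand (ξ : ℂ) : ℂ := Complex.exp (Complex.I * ξ ^ 2)

/-- The Fresnel-type integral `∫_w^{∞ e^{iπ/4}} e^{iξ²} dξ`. -/
def fresnel (w : ℝ) : ℂ := rayIntegral fresnelIntegrand (w : ℂ) (Real.pi / 4)

/-- The leading term `e^{-iω²} √(2/(λ_c t)) ∫_ω^{∞ e^{iπ/4}} e^{iξ²} dξ`. -/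
def leadingTerm (δ t Lam : ℝ) : ℂ :=
  Complex.exp (-Complex.I * (omega δ t Lam : ℂ) ^ 2) * (Real.sqrt (2 / (lamC δ t * t)) : ℂ) *
    fresnel (omega δ t Lam)

end UniformJB

end

open UniformJB

/-!
The substitution `1 - z = (1 - ζ) λ_c / (1 + λ_c)` turns `J_B` into `J̃_B`, whose contour starts at
`0`, the saddle point for `λ = λ_c`. By Cauchy's theorem the contour may be rotated, for all
`λ ≥ λ_c` at once, to a direction `φ` with `tan φ` comparable to `1 / log t`, along which `Im f₁`
dominates a quadratic. There the integrand is compared with its quadratic model, whose integral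
rotates to a scaled Fresnel integral. With `n = √(λ_c t / 2) ≥ t ^ (δ / 2) / 2` the error is
`O(n⁻² (1 + ω)⁻¹)` up to a power of `log t`. Writing the Fresnel integral as a Gaussian average of
`1 / (a - i x)` bounds it from below by a multiple of `(1 + ω)⁻¹`, so that the leading term is at
least a multiple of `n⁻¹ (1 + ω)⁻¹` and the relative error tends to `0`, uniformly.
-/

namespace UniformJB

open Set Filter Topology MeasureTheory
open Complex (I)
open scoped Real

theorem rayPoint_zero_eq (φ r : ℝ) : rayPoint 0 φ r = r * Complex.exp (I * φ) := by
  simp [rayPoint]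

theorem norm_exp_I_mul (φ : ℝ) : ‖Complex.exp (I * φ)‖ = 1 := by
  rw [mul_comm, Complex.norm_exp_ofReal_mul_I]

theorem norm_rayPoint_zero (φ : ℝ) {r : ℝ} (hr : 0 ≤ r) : ‖rayPoint 0 φ r‖ = r := by
  rw [rayPoint_zero_eq, norm_mul, norm_exp_I_mul, mul_one, Complex.norm_of_nonneg hr]

theorem rayPoint_zero_re (φ r : ℝ) : (rayPoint 0 φ r).re = r * Real.cos φ := by
  rw [rayPoint_zero_eq, mul_comm I, Complex.re_ofReal_mul, Complex.exp_ofReal_mul_I_re]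

theorem rayPoint_zero_im (φ r : ℝ) : (rayPoint 0 φ r).im = r * Real.sin φ := by
  rw [rayPoint_zero_eq, mul_comm I, Complex.im_ofReal_mul, Complex.exp_ofReal_mul_I_im]

theorem continuous_rayPoint (a : ℂ) (φ : ℝ) : Continuous (rayPoint a φ) := by
  unfold rayPoint; fun_prop

theorem continuousOn_comp_rayPoint {f : ℂ → ℂ} {a : ℂ} {φ : ℝ}
    (hf : ∀ r, 0 ≤ r → ContinuousAt f (rayPoint a φ r)) :
    ContinuousOn (fun r : ℝ => f (rayPoint a φ r) * Complex.exp (I * φ)) (Ici 0) := fun r hr =>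
  ((ContinuousAt.comp (hf r hr) (continuous_rayPoint a φ).continuousAt).mul
    continuousAt_const).continuousWithinAt

theorem rayIntegrable_of_exp_decay {f : ℂ → ℂ} {a : ℂ} {φ K c : ℝ} (hc : 0 < c)
    (hf : ∀ r, 0 ≤ r → ContinuousAt f (rayPoint a φ r))
    (hK : ∀ᶠ r in atTop, ‖f (rayPoint a φ r)‖ ≤ K * Real.exp (-c * r)) :
    RayIntegrable f a φ := by
  have hcont := continuousOn_comp_rayPoint hf
  have hnorm := integrable_of_isBigO_exp_neg hc hcont.norm
    (Asymptotics.IsBigO.of_bound K (hK.mono fun r hr => by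
      rwa [norm_norm, norm_mul, norm_exp_I_mul, mul_one, Real.norm_of_nonneg (Real.exp_nonneg _)]))
  exact (integrable_norm_iff
    ((hcont.mono Ioi_subset_Ici_self).aestronglyMeasurable measurableSet_Ioi)).1 hnorm

section Rotation

theorem integrableOn_Ioi_comp_exp {F : ℝ → ℂ} :
    Integrable (fun x : ℝ => Real.exp x • F (Real.exp x)) ↔ IntegrableOn F (Ioi 0) := by
  have := integrableOn_image_iff_integrableOn_abs_deriv_smul MeasurableSet.univ
    (fun x _ => (Real.hasDerivAt_exp x).hasDerivWithinAt) Real.exp_injective.injOn F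
  simpa only [image_univ, Real.range_exp, Real.abs_exp, integrableOn_univ] using this.symm

theorem integral_comp_exp (F : ℝ → ℂ) :
    ∫ x : ℝ, Real.exp x • F (Real.exp x) = ∫ r in Ioi (0 : ℝ), F r := by
  have := integral_image_eq_integral_abs_deriv_smul MeasurableSet.univ
    (fun x _ => (Real.hasDerivAt_exp x).hasDerivWithinAt) Real.exp_injective.injOn F
  simpa only [image_univ, Real.range_exp, Real.abs_exp, setIntegral_univ] using this.symm

/-- The pullback of the differential `f(z) dz` under `w ↦ a + e^w`. It turns the ray of direction
`θ` from `a` into the horizontal line of height `θ`, and a sector with vertex `a` into a strip. -/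
noncomputable def expPullback (f : ℂ → ℂ) (a w : ℂ) : ℂ := f (a + Complex.exp w) * Complex.exp w

variable {f : ℂ → ℂ} {a : ℂ} {φ₁ φ₂ θ K c : ℝ}

theorem add_exp_add_mul_I (a : ℂ) (x θ : ℝ) :
    a + Complex.exp (x + θ * I) = rayPoint a θ (Real.exp x) := by
  rw [rayPoint, Complex.exp_add, Complex.ofReal_exp, mul_comm I]

theorem norm_expPullback (f : ℂ → ℂ) (a : ℂ) (x θ : ℝ) :
    ‖expPullback f a (x + θ * I)‖ = ‖f (rayPoint a θ (Real.exp x))‖ * Real.exp x := by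
  rw [expPullback, add_exp_add_mul_I, norm_mul, Complex.norm_exp]
  simp

theorem tendsto_integral_expPullback (hf : RayIntegrable f a θ) :
    Tendsto (fun n : ℝ => ∫ x in -n..n, expPullback f a (x + θ * I)) atTop
      (𝓝 (rayIntegral f a θ)) := by
  have hpull : (fun x : ℝ => expPullback f a (x + θ * I)) = fun x : ℝ =>
      Real.exp x • (f (rayPoint a θ (Real.exp x)) * Complex.exp (I * θ)) := by
    funext x
    rw [expPullback, add_exp_add_mul_I, Complex.exp_add, Complex.real_smul, Complex.ofReal_exp,
      mul_comm I]
    ring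
  rw [rayIntegral, ← integral_comp_exp, hpull]
  exact intervalIntegral_tendsto_integral (integrableOn_Ioi_comp_exp.2 hf)
    tendsto_neg_atTop_atBot tendsto_id

theorem tendsto_integral_expPullback_atTop (hφ : φ₁ ≤ φ₂) (hc : 0 < c)
    (hK : ∀ᶠ r in atTop, ∀ θ ∈ Icc φ₁ φ₂, ‖f (rayPoint a θ r)‖ ≤ K * Real.exp (-c * r)) :
    Tendsto (fun n : ℝ => ∫ y in φ₁..φ₂, expPullback f a (n + y * I)) atTop (𝓝 0) := by
  have hlim : Tendsto (fun n : ℝ => K * Real.exp (-c * Real.exp n) * Real.exp n * |φ₂ - φ₁|)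
      atTop (𝓝 0) := by
    have := (((tendsto_rpow_mul_exp_neg_mul_atTop_nhds_zero 1 c hc).comp
      Real.tendsto_exp_atTop).const_mul K).mul_const |φ₂ - φ₁|
    simpa [mul_assoc, mul_comm, mul_left_comm] using this
  refine squeeze_zero_norm' ?_ hlim
  filter_upwards [Real.tendsto_exp_atTop.eventually hK] with n hn
  refine intervalIntegral.norm_integral_le_of_norm_le_const fun y hy => ?_
  rw [uIoc_of_le hφ] at hy
  rw [norm_expPullback]
  exact mul_le_mul_of_nonneg_right (hn y (Ioc_subset_Icc_self hy)) (Real.exp_pos n).le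

theorem tendsto_integral_expPullback_atBot (φ₁ φ₂ : ℝ) (ha : ContinuousAt f a) :
    Tendsto (fun n : ℝ => ∫ y in φ₁..φ₂, expPullback f a (n + y * I)) atBot (𝓝 0) := by
  obtain ⟨ε, hε, hball⟩ := Metric.eventually_nhds_iff.1
    (ha.norm.eventually_lt continuousAt_const (lt_add_one ‖f a‖))
  have hlim : Tendsto (fun n : ℝ => (‖f a‖ + 1) * Real.exp n * |φ₂ - φ₁|) atBot (𝓝 0) := by
    simpa using (Real.tendsto_exp_atBot.const_mul (‖f a‖ + 1)).mul_const |φ₂ - φ₁|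
  refine squeeze_zero_norm' ?_ hlim
  filter_upwards [Real.tendsto_exp_atBot.eventually_lt_const hε] with n hn
  refine intervalIntegral.norm_integral_le_of_norm_le_const fun y _ => ?_
  rw [norm_expPullback]
  refine mul_le_mul_of_nonneg_right (hball ?_).le (Real.exp_pos n).le
  rwa [dist_eq_norm, rayPoint, add_sub_cancel_left, ← rayPoint_zero_eq,
    norm_rayPoint_zero _ (Real.exp_pos n).le]

theorem expPullback_boundary_rect_eq_zero
    (hd : ∀ r, 0 < r → ∀ θ ∈ uIcc φ₁ φ₂, DifferentiableAt ℂ f (rayPoint a θ r)) (n : ℝ) :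
    (∫ x in -n..n, expPullback f a (x + φ₁ * I)) - (∫ x in -n..n, expPullback f a (x + φ₂ * I)) +
      I • (∫ y in φ₁..φ₂, expPullback f a (n + y * I)) -
      I • (∫ y in φ₁..φ₂, expPullback f a ((-n : ℝ) + y * I)) = 0 := by
  have := Complex.integral_boundary_rect_eq_zero_of_differentiableOn (expPullback f a)
    ((-n : ℝ) + φ₁ * I) (n + φ₂ * I) fun w hw => ?_
  · simpa using this
  · have him : w.im ∈ uIcc φ₁ φ₂ := by simpa using hw.2
    have hf : DifferentiableAt ℂ f (a + Complex.exp w) := by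
      rw [← Complex.re_add_im w, add_exp_add_mul_I]
      exact hd _ (Real.exp_pos _) _ him
    exact ((DifferentiableAt.comp w hf (Complex.differentiableAt_exp.const_add a)).mul
      Complex.differentiableAt_exp).differentiableWithinAt

theorem rayIntegral_eq_of_exp_decay (hφ : φ₁ ≤ φ₂) (hc : 0 < c) (ha : ContinuousAt f a)
    (hd : ∀ r, 0 < r → ∀ θ ∈ Icc φ₁ φ₂, DifferentiableAt ℂ f (rayPoint a θ r))
    (hK : ∀ᶠ r in atTop, ∀ θ ∈ Icc φ₁ φ₂, ‖f (rayPoint a θ r)‖ ≤ K * Real.exp (-c * r)) :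
    rayIntegral f a φ₁ = rayIntegral f a φ₂ := by
  have hint : ∀ θ ∈ Icc φ₁ φ₂, RayIntegrable f a θ := fun θ hθ =>
    rayIntegrable_of_exp_decay hc
      (fun r hr => hr.eq_or_lt.elim (fun h => by simpa [rayPoint, ← h] using ha)
        fun h => (hd r h θ hθ).continuousAt)
      (hK.mono fun r hr => hr θ hθ)
  have hhoriz := (tendsto_integral_expPullback (hint φ₁ (left_mem_Icc.2 hφ))).sub
    (tendsto_integral_expPullback (hint φ₂ (right_mem_Icc.2 hφ)))
  have hright := (tendsto_integral_expPullback_atTop hφ hc hK).const_smul I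
  have hleft := ((tendsto_integral_expPullback_atBot φ₁ φ₂ ha).comp
    tendsto_neg_atTop_atBot).const_smul I
  rw [← uIcc_of_le hφ] at hd
  have := tendsto_nhds_unique ((hhoriz.add hright).sub hleft)
    (tendsto_const_nhds.congr fun n => (expPullback_boundary_rect_eq_zero hd n).symm)
  simpa [sub_eq_zero] using this

end Rotation

section HalfGauss

/-- The half-line Gaussian integral `∫_0^∞ e^{-s² - 2as} ds`, a scaled complementary error function.
The Fresnel integral is its restriction to the ray of direction `e^{-iπ/4}`. -/
noncomputable def halfGauss (a : ℂ) : ℂ :=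
  ∫ s in Ioi (0 : ℝ), Complex.exp (-(s : ℂ) ^ 2 - 2 * a * s)

theorem norm_exp_neg_sq_sub (a : ℂ) (s : ℝ) :
    ‖Complex.exp (-(s : ℂ) ^ 2 - 2 * a * s)‖ = Real.exp (-s ^ 2 - 2 * a.re * s) := by
  rw [Complex.norm_exp]
  congr 1
  simp [← Complex.ofReal_pow]

theorem integrableOn_exp_neg_sq (s : Set ℝ) : IntegrableOn (fun x : ℝ => Real.exp (-x ^ 2)) s := by
  simpa using (integrable_exp_neg_mul_sq one_pos).integrableOn

theorem integrableOn_exp_neg_mul_Ioi {b : ℝ} (hb : 0 < b) :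
    IntegrableOn (fun x : ℝ => Real.exp (-(b * x))) (Ioi 0) := by
  simpa only [neg_mul] using integrableOn_exp_mul_Ioi (neg_neg_of_pos hb) 0

theorem integrableOn_pow_mul_exp_neg_mul_Ioi (n : ℕ) {b : ℝ} (hb : 0 < b) :
    IntegrableOn (fun x : ℝ => x ^ n * Real.exp (-(b * x))) (Ioi 0) := by
  have := integrableOn_rpow_mul_exp_neg_mul_rpow (s := n) (p := 1)
    (by linarith [n.cast_nonneg (α := ℝ)]) one_pos hb
  simpa only [Real.rpow_natCast, Real.rpow_one, neg_mul] using this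

theorem integral_pow_mul_exp_neg_mul_Ioi (n : ℕ) {b : ℝ} (hb : 0 < b) :
    ∫ x in Ioi (0 : ℝ), x ^ n * Real.exp (-(b * x)) = n.factorial / b ^ (n + 1) := by
  have := Real.integral_rpow_mul_exp_neg_mul_Ioi (a := n + 1) (by positivity) hb
  simp only [add_sub_cancel_right, Real.rpow_natCast, Real.Gamma_nat_eq_factorial] at this
  rw [this, ← Nat.cast_add_one, Real.rpow_natCast, one_div, inv_pow, inv_mul_eq_div]

theorem one_add_pow_le_mul_exp (m : ℕ) {b x : ℝ} (hb : 0 < b) (hx : 0 ≤ x) :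
    (1 + x) ^ m ≤ m.factorial / b ^ m * Real.exp b * Real.exp (b * x) := by
  have h := Real.pow_div_factorial_le_exp (b * (1 + x)) (by positivity) m
  rw [div_le_iff₀ (by positivity), mul_pow, mul_add, mul_one, Real.exp_add] at h
  rw [div_mul_eq_mul_div, div_mul_eq_mul_div, le_div_iff₀ (by positivity)]
  linarith

theorem one_add_pow_mul_exp_neg_mul_le (m : ℕ) {b x : ℝ} (hb : 0 < b) (hx : 0 ≤ x) :
    (1 + x) ^ m * Real.exp (-(b * x)) ≤
      m.factorial / (b / 2) ^ m * Real.exp (b / 2) * Real.exp (-(b / 2 * x)) := by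
  have hexp : Real.exp (-(b / 2 * x)) = Real.exp (b / 2 * x) * Real.exp (-(b * x)) := by
    rw [← Real.exp_add]
    ring_nf
  rw [hexp, ← mul_assoc]
  gcongr
  exact one_add_pow_le_mul_exp m (by positivity) hx

theorem integrableOn_one_add_pow_mul_exp_neg_mul_Ioi (m : ℕ) {b : ℝ} (hb : 0 < b) :
    IntegrableOn (fun x => (1 + x) ^ m * Real.exp (-(b * x))) (Ioi 0) := by
  refine ((integrableOn_exp_neg_mul_Ioi (half_pos hb)).const_mul
    (m.factorial / (b / 2) ^ m * Real.exp (b / 2))).mono' (by fun_prop) ?_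
  filter_upwards [ae_restrict_mem measurableSet_Ioi] with x (hx : 0 < x)
  rw [Real.norm_of_nonneg (by positivity)]
  exact one_add_pow_mul_exp_neg_mul_le m hb hx.le

theorem integral_one_add_pow_mul_exp_neg_mul_Ioi_le (m : ℕ) {b : ℝ} (hb : 0 < b) :
    ∫ x in Ioi (0 : ℝ), (1 + x) ^ m * Real.exp (-(b * x)) ≤
      m.factorial / (b / 2) ^ (m + 1) * Real.exp (b / 2) := by
  have hexp := integral_pow_mul_exp_neg_mul_Ioi 0 (half_pos hb)
  simp only [pow_zero, one_mul, Nat.factorial_zero, Nat.cast_one, zero_add, pow_one] at hexp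
  calc ∫ x in Ioi (0 : ℝ), (1 + x) ^ m * Real.exp (-(b * x))
      ≤ ∫ x in Ioi (0 : ℝ),
          m.factorial / (b / 2) ^ m * Real.exp (b / 2) * Real.exp (-(b / 2 * x)) :=
        setIntegral_mono_on (integrableOn_one_add_pow_mul_exp_neg_mul_Ioi m hb)
          ((integrableOn_exp_neg_mul_Ioi (half_pos hb)).const_mul _) measurableSet_Ioi
          fun x (hx : 0 < x) => one_add_pow_mul_exp_neg_mul_le m hb hx.le
    _ = m.factorial / (b / 2) ^ (m + 1) * Real.exp (b / 2) := by
        rw [integral_const_mul, hexp, pow_succ]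
        field_simp

variable {a : ℂ}

theorem norm_exp_neg_sq_sub_le (ha : 0 ≤ a.re) :
    ∀ᵐ s : ℝ ∂volume.restrict (Ioi 0),
      ‖Complex.exp (-(s : ℂ) ^ 2 - 2 * a * s)‖ ≤ Real.exp (-s ^ 2) := by
  filter_upwards [ae_restrict_mem measurableSet_Ioi] with s (hs : 0 < s)
  rw [norm_exp_neg_sq_sub]
  gcongr
  linarith [mul_nonneg ha hs.le]

theorem integrableOn_exp_neg_sq_sub (ha : 0 ≤ a.re) :
    IntegrableOn (fun s : ℝ => Complex.exp (-(s : ℂ) ^ 2 - 2 * a * s)) (Ioi 0) :=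
  (integrableOn_exp_neg_sq _).mono' (by fun_prop) (norm_exp_neg_sq_sub_le ha)

theorem norm_halfGauss_le (ha : 0 ≤ a.re) : ‖halfGauss a‖ ≤ √π / 2 := by
  have h := integral_gaussian_Ioi 1
  simp only [neg_mul, one_mul, div_one] at h
  rw [← h]
  exact norm_integral_le_of_norm_le (integrableOn_exp_neg_sq _) (norm_exp_neg_sq_sub_le ha)

theorem halfGauss_zero : halfGauss 0 = ((√π / 2 : ℝ) : ℂ) := by
  have h := integral_gaussian_Ioi 1
  simp only [neg_mul, one_mul, div_one] at h
  rw [halfGauss, ← h, ← integral_complex_ofReal]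
  simp

theorem norm_exp_neg_sq_sub_sub_exp_le (a : ℂ) (s : ℝ) :
    ‖Complex.exp (-(s : ℂ) ^ 2 - 2 * a * s) - Complex.exp (-(2 * a) * s)‖ ≤
      s ^ 2 * Real.exp (-(2 * a.re * s)) := by
  have hfac : Complex.exp (-(s : ℂ) ^ 2 - 2 * a * s) - Complex.exp (-(2 * a) * s) =
      ((Real.exp (-s ^ 2) - 1 : ℝ) : ℂ) * Complex.exp (-(2 * a) * s) := by
    push_cast
    rw [sub_mul, ← Complex.exp_add, one_mul]
    ring_nf
  have hone_sub : |Real.exp (-s ^ 2) - 1| ≤ s ^ 2 := by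
    rw [abs_sub_comm, abs_of_nonneg (sub_nonneg.2 (Real.exp_le_one_iff.2 (by nlinarith)))]
    linarith [Real.add_one_le_exp (-s ^ 2)]
  have hre : (-(2 * a) * (s : ℂ)).re = -(2 * a.re * s) := by simp
  rw [hfac, norm_mul, Complex.norm_exp, Complex.norm_real, Real.norm_eq_abs, hre]
  gcongr

theorem norm_halfGauss_sub_le (ha : 0 < a.re) :
    ‖halfGauss a - 1 / (2 * a)‖ ≤ 1 / (4 * a.re ^ 3) := by
  have hre : (-(2 * a)).re < 0 := by simpa using ha
  have hlead : ∫ s in Ioi (0 : ℝ), Complex.exp (-(2 * a) * s) = 1 / (2 * a) := by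
    rw [integral_exp_mul_complex_Ioi hre]
    simp
  have hval : (Nat.factorial 2 : ℝ) / (2 * a.re) ^ (2 + 1) = 1 / (4 * a.re ^ 3) := by
    norm_num [Nat.factorial]
    field_simp
    norm_num
  rw [halfGauss, ← hlead, ← integral_sub (integrableOn_exp_neg_sq_sub ha.le)
    (integrableOn_exp_mul_complex_Ioi hre 0), ← hval,
    ← integral_pow_mul_exp_neg_mul_Ioi 2 (mul_pos two_pos ha)]
  exact norm_integral_le_of_norm_le (integrableOn_pow_mul_exp_neg_mul_Ioi 2 (mul_pos two_pos ha))
    (Eventually.of_forall (norm_exp_neg_sq_sub_sub_exp_le a))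

end HalfGauss

section GaussianAverage

variable {a : ℂ}

/-- The kernel `e^{-x²} e^{-2(a - ix)s}`. Integrated over `s > 0` it is half the Gaussian weight
divided by `a - ix`, integrated over `x` it is `√π` times the integrand of `halfGauss a`. -/
noncomputable def halfGaussKernel (a : ℂ) (s x : ℝ) : ℂ :=
  Complex.exp (-(x : ℂ) ^ 2) * Complex.exp (-(2 * (a - I * x)) * s)

theorem norm_halfGaussKernel (a : ℂ) (s x : ℝ) :
    ‖halfGaussKernel a s x‖ = Real.exp (-(2 * a.re * s)) * Real.exp (-1 * x ^ 2) := by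
  rw [halfGaussKernel, norm_mul, Complex.norm_exp, Complex.norm_exp, mul_comm]
  congr 2
  · simp
  · simp [← Complex.ofReal_pow]

theorem integrable_halfGaussKernel (ha : 0 < a.re) :
    Integrable (Function.uncurry (halfGaussKernel a))
      ((volume.restrict (Ioi (0 : ℝ))).prod (volume : Measure ℝ)) := by
  refine ((integrableOn_exp_neg_mul_Ioi (mul_pos two_pos ha)).mul_prod
    (integrable_exp_neg_mul_sq one_pos)).mono' (Continuous.aestronglyMeasurable ?_)
    (Eventually.of_forall fun p => (norm_halfGaussKernel a p.1 p.2).le)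
  simp only [Function.uncurry_def, halfGaussKernel]
  fun_prop

theorem integral_halfGaussKernel_left (ha : 0 < a.re) (x : ℝ) :
    ∫ s in Ioi (0 : ℝ), halfGaussKernel a s x =
      1 / 2 * (Complex.exp (-(x : ℂ) ^ 2) / (a - I * x)) := by
  have hre : (-(2 * (a - I * x))).re < 0 := by simpa using ha
  have : a - I * x ≠ 0 := fun h => by simp [h] at hre
  simp only [halfGaussKernel]
  rw [integral_const_mul, integral_exp_mul_complex_Ioi hre]
  simp only [Complex.ofReal_zero, mul_zero, Complex.exp_zero]
  field_simp

theorem integral_halfGaussKernel_right (a : ℂ) (s : ℝ) :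
    ∫ x : ℝ, halfGaussKernel a s x = (√π : ℂ) * Complex.exp (-(s : ℂ) ^ 2 - 2 * a * s) := by
  have hker : halfGaussKernel a s = fun x : ℝ => Complex.exp (-(2 * a * s)) *
      (Complex.exp (I * (2 * s) * x) * Complex.exp (-1 * (x : ℂ) ^ 2)) := by
    funext x
    simp only [halfGaussKernel, ← Complex.exp_add]
    ring_nf
  have hsqrt : ((π : ℂ) / 1) ^ (1 / 2 : ℂ) = (√π : ℂ) := by
    rw [div_one, Real.sqrt_eq_rpow, Complex.ofReal_cpow Real.pi_pos.le]
    norm_num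
  rw [hker, integral_const_mul, fourierIntegral_gaussian (by simp), hsqrt, mul_left_comm,
    ← Complex.exp_add]
  ring_nf

theorem integrable_gaussian_div_sub (ha : 0 < a.re) :
    Integrable fun x : ℝ => Complex.exp (-(x : ℂ) ^ 2) / (a - I * x) := by
  have := (integrable_halfGaussKernel ha).integral_prod_right
  simp only [Function.uncurry_apply_pair, integral_halfGaussKernel_left ha] at this
  simpa using this.const_mul 2

theorem halfGauss_eq_integral (ha : 0 < a.re) :
    halfGauss a = 1 / (2 * (√π : ℂ)) * ∫ x : ℝ, Complex.exp (-(x : ℂ) ^ 2) / (a - I * x) := by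
  have hpi : (√π : ℂ) ≠ 0 := mod_cast (Real.sqrt_pos.2 Real.pi_pos).ne'
  have hswap := integral_integral_swap (integrable_halfGaussKernel ha)
  simp only [integral_halfGaussKernel_left ha, integral_halfGaussKernel_right,
    integral_const_mul] at hswap
  rw [halfGauss, ← mul_right_inj' hpi, hswap, ← mul_assoc]
  congr 1
  field_simp

theorem re_gaussian_div_sub (a : ℂ) (x : ℝ) :
    (Complex.exp (-(x : ℂ) ^ 2) / (a - I * x)).re =
      Real.exp (-x ^ 2) * (a.re / ‖a - I * x‖ ^ 2) := by
  have hexp : Complex.exp (-(x : ℂ) ^ 2) = (Real.exp (-x ^ 2) : ℝ) := by push_cast; rfl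
  rw [hexp, div_eq_mul_inv, Complex.re_ofReal_mul, Complex.inv_re, Complex.normSq_eq_norm_sq]
  simp

theorem halfGauss_re (ha : 0 < a.re) :
    (halfGauss a).re =
      1 / (2 * √π) * ∫ x : ℝ, Real.exp (-x ^ 2) * (a.re / ‖a - I * x‖ ^ 2) := by
  have hcoef : 1 / (2 * (√π : ℂ)) = ((1 / (2 * √π) : ℝ) : ℂ) := by push_cast; rfl
  simp only [← re_gaussian_div_sub]
  rw [halfGauss_eq_integral ha, hcoef, Complex.re_ofReal_mul]
  congr 1
  exact (integral_re (integrable_gaussian_div_sub ha)).symm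

-- On `[0, m]` the Poisson kernel is at least a constant multiple of `a.re / ‖a‖ ^ 2`; the length
-- `m` is comparable with `min ‖a‖ 1`.
theorem le_halfGauss_re (ha : 0 < a.re) :
    Real.exp (-1) / (8 * √π) * (a.re / (‖a‖ * (1 + ‖a‖))) ≤ (halfGauss a).re := by
  have hna : 0 < ‖a‖ := ha.trans_le (Complex.re_le_norm a)
  have hint : Integrable fun x : ℝ => Real.exp (-x ^ 2) * (a.re / ‖a - I * x‖ ^ 2) :=
    (integrable_gaussian_div_sub ha).re.congr (Eventually.of_forall (re_gaussian_div_sub a))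
  obtain ⟨m, hm⟩ : ∃ m, m = ‖a‖ / (1 + ‖a‖) := ⟨_, rfl⟩
  have hm0 : 0 ≤ m := hm ▸ by positivity
  have hm1 : m ≤ 1 := hm ▸ div_le_one_of_le₀ (by linarith) (by positivity)
  have hma : m ≤ ‖a‖ := hm ▸ div_le_self hna.le (by linarith)
  have hpt : ∀ x ∈ Icc 0 m,
      Real.exp (-1) * (a.re / (2 * ‖a‖) ^ 2) ≤ Real.exp (-x ^ 2) * (a.re / ‖a - I * x‖ ^ 2) := by
    intro x hx
    have hne : 0 < ‖a - I * x‖ := norm_pos_iff.2 fun h => by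
      simpa [ha.ne'] using congrArg Complex.re h
    have hle : ‖a - I * x‖ ≤ 2 * ‖a‖ := by
      refine (norm_sub_le _ _).trans ?_
      rw [norm_mul, Complex.norm_I, one_mul, Complex.norm_of_nonneg hx.1]
      linarith [hx.2]
    have hsq : -1 ≤ -x ^ 2 := by nlinarith [hx.1, hx.2]
    gcongr
  calc Real.exp (-1) / (8 * √π) * (a.re / (‖a‖ * (1 + ‖a‖)))
      = 1 / (2 * √π) * ∫ _ in Icc 0 m, Real.exp (-1) * (a.re / (2 * ‖a‖) ^ 2) := by
        rw [setIntegral_const, Real.volume_real_Icc_of_le hm0, smul_eq_mul, sub_zero, hm]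
        field_simp
        norm_num
    _ ≤ 1 / (2 * √π) * ∫ x in Icc 0 m, Real.exp (-x ^ 2) * (a.re / ‖a - I * x‖ ^ 2) := by
        refine mul_le_mul_of_nonneg_left ?_ (by positivity)
        exact setIntegral_mono_on continuous_const.integrableOn_Icc hint.integrableOn
          measurableSet_Icc hpt
    _ ≤ 1 / (2 * √π) * ∫ x : ℝ, Real.exp (-x ^ 2) * (a.re / ‖a - I * x‖ ^ 2) := by
        refine mul_le_mul_of_nonneg_left ?_ (by positivity)
        exact setIntegral_le_integral hint (Eventually.of_forall fun x => by positivity)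
    _ = (halfGauss a).re := (halfGauss_re ha).symm

end GaussianAverage

section Fresnel

/-- The direction `e^{iπ/4}` of the Fresnel contour. -/
noncomputable def diagDir : ℂ := Complex.exp (I * (π / 4 : ℝ))

/-- The direction `e^{-iπ/4}`, inverse to `diagDir`. -/
noncomputable def antidiagDir : ℂ := Complex.exp ((-(π / 4) : ℝ) * I)

theorem diagDir_sq : diagDir ^ 2 = I := by
  have : ((2 : ℕ) : ℂ) * (I * (π / 4 : ℝ)) = π / 2 * I := by push_cast; ring
  rw [diagDir, ← Complex.exp_nat_mul, this, Complex.exp_pi_div_two_mul_I]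

theorem diagDir_mul_antidiagDir : diagDir * antidiagDir = 1 := by
  rw [diagDir, antidiagDir, ← Complex.exp_add, Complex.exp_eq_one_iff]
  exact ⟨0, by push_cast; ring⟩

theorem I_mul_diagDir : I * diagDir = -antidiagDir := by
  linear_combination antidiagDir * Complex.I_mul_I +
    (antidiagDir * I) * diagDir_sq - (I * diagDir) * diagDir_mul_antidiagDir

theorem norm_diagDir : ‖diagDir‖ = 1 := norm_exp_I_mul _

theorem norm_antidiagDir : ‖antidiagDir‖ = 1 := Complex.norm_exp_ofReal_mul_I _

theorem re_ofReal_mul_antidiagDir (w : ℝ) : (w * antidiagDir).re = w * (√2 / 2) := by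
  rw [Complex.re_ofReal_mul, antidiagDir, Complex.exp_ofReal_mul_I_re, Real.cos_neg,
    Real.cos_pi_div_four]

theorem fresnelIntegrand_rayPoint (w s : ℝ) :
    fresnelIntegrand (rayPoint w (π / 4) s) =
      Complex.exp (I * (w : ℂ) ^ 2) *
        Complex.exp (-(s : ℂ) ^ 2 - 2 * (w * antidiagDir) * s) := by
  rw [fresnelIntegrand, rayPoint, ← Complex.exp_add]
  congr 1
  change I * (w + s * diagDir) ^ 2 = _
  linear_combination (s : ℂ) ^ 2 * Complex.I_mul_I + (I * (s : ℂ) ^ 2) * diagDir_sq +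
    (2 * w * s : ℂ) * I_mul_diagDir

theorem rayIntegrable_fresnelIntegrand {w : ℝ} (hw : 0 ≤ w) :
    RayIntegrable fresnelIntegrand w (π / 4) := by
  simp only [RayIntegrable, fresnelIntegrand_rayPoint]
  refine ((integrableOn_exp_neg_sq_sub ?_).const_mul _).mul_const _
  rw [re_ofReal_mul_antidiagDir]
  positivity

theorem fresnel_eq (w : ℝ) :
    fresnel w = Complex.exp (I * (w : ℂ) ^ 2) * (diagDir * halfGauss (w * antidiagDir)) := by
  simp only [fresnel, rayIntegral, halfGauss, fresnelIntegrand_rayPoint, integral_mul_const,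
    integral_const_mul]
  rw [diagDir]
  ring

theorem exp_mul_fresnel (w : ℝ) :
    Complex.exp (-I * (w : ℂ) ^ 2) * fresnel w = diagDir * halfGauss (w * antidiagDir) := by
  rw [fresnel_eq, ← mul_assoc, ← Complex.exp_add, ← add_mul, neg_add_cancel, zero_mul,
    Complex.exp_zero, one_mul]

theorem norm_exp_neg_I_mul_sq (w : ℝ) : ‖Complex.exp (-I * (w : ℂ) ^ 2)‖ = 1 := by
  rw [Complex.norm_exp]
  simp [← Complex.ofReal_pow]

theorem norm_fresnel (w : ℝ) : ‖fresnel w‖ = ‖halfGauss (w * antidiagDir)‖ := by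
  rw [← one_mul ‖fresnel w‖, ← norm_exp_neg_I_mul_sq w, ← norm_mul, exp_mul_fresnel, norm_mul,
    norm_diagDir, one_mul]

theorem norm_fresnel_le {w : ℝ} (hw : 0 ≤ w) : ‖fresnel w‖ ≤ √π / 2 := by
  rw [norm_fresnel]
  refine norm_halfGauss_le ?_
  rw [re_ofReal_mul_antidiagDir]
  positivity

theorem norm_exp_mul_fresnel_sub_le {w : ℝ} (hw : 0 < w) :
    ‖Complex.exp (-I * (w : ℂ) ^ 2) * fresnel w - -1 / (2 * I * w)‖ ≤ 1 / w ^ 3 := by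
  have hw0 : (w : ℂ) ≠ 0 := mod_cast hw.ne'
  have hre := re_ofReal_mul_antidiagDir w
  have hsqrt : √2 ^ 2 = (2 : ℝ) := Real.sq_sqrt zero_le_two
  have hlead : -1 / (2 * I * (w : ℂ)) = diagDir * (1 / (2 * (w * antidiagDir))) := by
    have : antidiagDir ≠ 0 := Complex.exp_ne_zero _
    field_simp
    linear_combination -I_mul_diagDir
  rw [exp_mul_fresnel, hlead, ← mul_sub, norm_mul, norm_diagDir, one_mul]
  calc ‖halfGauss (w * antidiagDir) - 1 / (2 * (w * antidiagDir))‖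
      ≤ 1 / (4 * (w * (√2 / 2)) ^ 3) := hre ▸ norm_halfGauss_sub_le (by rw [hre]; positivity)
    _ = 1 / (√2 * w ^ 3) := by
        congr 1
        linear_combination (w ^ 3 * √2 / 2) * hsqrt
    _ ≤ 1 / w ^ 3 := by
        gcongr
        exact le_mul_of_one_le_left (by positivity) (Real.one_le_sqrt.2 one_le_two)

theorem exists_le_norm_fresnel : ∃ c : ℝ, 0 < c ∧ ∀ w : ℝ, 0 ≤ w → c / (1 + w) ≤ ‖fresnel w‖ := by
  obtain ⟨c, hc⟩ : ∃ c, c = Real.exp (-1) / (8 * √π) * (√2 / 2) := ⟨_, rfl⟩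
  refine ⟨min c (√π / 2), lt_min (hc ▸ by positivity) (by positivity), fun w hw => ?_⟩
  rw [norm_fresnel]
  rcases hw.eq_or_lt with rfl | hw
  · rw [Complex.ofReal_zero, zero_mul, halfGauss_zero, Complex.norm_of_nonneg (by positivity),
      add_zero, div_one]
    exact min_le_right _ _
  · have hre := re_ofReal_mul_antidiagDir w
    have hnorm : ‖w * antidiagDir‖ = w := by
      rw [norm_mul, norm_antidiagDir, mul_one, Complex.norm_of_nonneg hw.le]
    calc min c (√π / 2) / (1 + w)
        ≤ c / (1 + w) := by gcongr; exact min_le_left _ _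
      _ = Real.exp (-1) / (8 * √π) * (w * (√2 / 2) / (w * (1 + w))) := by
          rw [hc]
          field_simp
      _ ≤ (halfGauss (w * antidiagDir)).re := by
          have := le_halfGauss_re (a := w * antidiagDir) (by rw [hre]; positivity)
          rwa [hre, hnorm] at this
      _ ≤ ‖halfGauss (w * antidiagDir)‖ := Complex.re_le_norm _

end Fresnel

section QuadraticModel

/-- The exponent `i (N ζ² + 2 √N w ζ) = i ((√N ζ + w)² - w²)` that `i t h(ζ)` is compared with;
there `N = λ_c t / 2` and `w = ω`. -/
noncomputable def quadraticModel (N w : ℝ) (ζ : ℂ) : ℂ := I * (N * ζ ^ 2 + 2 * √N * w * ζ)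

theorem differentiable_quadraticModel (N w : ℝ) : Differentiable ℂ (quadraticModel N w) := by
  unfold quadraticModel; fun_prop

theorem re_quadraticModel_rayPoint (N w φ r : ℝ) :
    (quadraticModel N w (rayPoint 0 φ r)).re =
      -(N * Real.sin (2 * φ) * r ^ 2 + 2 * √N * w * (r * Real.sin φ)) := by
  rw [quadraticModel, Complex.I_mul_re, Real.sin_two_mul]
  simp only [sq, Complex.add_im, Complex.mul_im, Complex.mul_re, Complex.ofReal_re,
    Complex.ofReal_im, Complex.re_ofNat, Complex.im_ofNat, rayPoint_zero_re, rayPoint_zero_im]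
  ring

theorem quadraticModel_rayPoint_pi_div_four {N : ℝ} (hN : 0 ≤ N) (w r : ℝ) :
    quadraticModel N w (rayPoint 0 (π / 4) r) =
      -((√N * r : ℝ) : ℂ) ^ 2 - 2 * (w * antidiagDir) * (√N * r : ℝ) := by
  rw [quadraticModel, rayPoint_zero_eq, ← diagDir]
  have hNs : (√N : ℂ) ^ 2 = N := mod_cast Real.sq_sqrt hN
  push_cast
  linear_combination (N * (r : ℂ) ^ 2) * Complex.I_mul_I + (I * N * (r : ℂ) ^ 2) * diagDir_sq +
    (2 * √N * w * r : ℂ) * I_mul_diagDir + (r : ℂ) ^ 2 * hNs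

variable {N w φ : ℝ}

theorem sin_two_mul_le_sin_two_mul {θ : ℝ} (hφ : 0 ≤ φ) (hθ : θ ∈ Icc φ (π / 4)) :
    Real.sin (2 * φ) ≤ Real.sin (2 * θ) :=
  Real.sin_le_sin_of_le_of_le_pi_div_two (by linarith [Real.pi_pos]) (by linarith [hθ.2])
    (by linarith [hθ.1])

theorem norm_exp_quadraticModel_le (hN : 0 ≤ N) (hw : 0 ≤ w) (hφ : 0 ≤ φ) :
    ∀ᶠ r in atTop, ∀ θ ∈ Icc φ (π / 4), ‖Complex.exp (quadraticModel N w (rayPoint 0 θ r))‖ ≤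
      1 * Real.exp (-(N * Real.sin (2 * φ)) * r) := by
  filter_upwards [eventually_ge_atTop 1] with r hr θ hθ
  have : 0 ≤ r := zero_le_one.trans hr
  have hsin : 0 ≤ Real.sin θ := Real.sin_nonneg_of_nonneg_of_le_pi (hφ.trans hθ.1)
    (by linarith [hθ.2, Real.pi_pos])
  have hsin2 : 0 ≤ Real.sin (2 * φ) := Real.sin_nonneg_of_nonneg_of_le_pi (by linarith)
    (by linarith [hθ.1, hθ.2, Real.pi_pos])
  have hsq : N * Real.sin (2 * φ) * r ≤ N * Real.sin (2 * θ) * r ^ 2 := by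
    have := sin_two_mul_le_sin_two_mul hφ hθ
    have := hsin2.trans this
    gcongr
    exact le_self_pow₀ hr two_ne_zero
  have hlin : 0 ≤ 2 * √N * w * (r * Real.sin θ) := by positivity
  rw [one_mul, Complex.norm_exp, re_quadraticModel_rayPoint]
  gcongr
  linarith

theorem sin_two_mul_pos (hφ0 : 0 < φ) (hφ : φ ≤ π / 4) : 0 < Real.sin (2 * φ) :=
  Real.sin_pos_of_pos_of_lt_pi (by linarith) (by linarith [Real.pi_pos])

theorem rayIntegrable_exp_quadraticModel (hN : 0 < N) (hw : 0 ≤ w) (hφ0 : 0 < φ)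
    (hφ : φ ≤ π / 4) : RayIntegrable (fun ζ => Complex.exp (quadraticModel N w ζ)) 0 φ :=
  rayIntegrable_of_exp_decay (mul_pos hN (sin_two_mul_pos hφ0 hφ))
    (fun _ _ => (differentiable_quadraticModel N w).cexp.continuous.continuousAt)
    ((norm_exp_quadraticModel_le hN.le hw hφ0.le).mono fun _ hr => hr φ ⟨le_rfl, hφ⟩)

theorem rayIntegral_exp_quadraticModel_pi_div_four (hN : 0 < N) (w : ℝ) :
    rayIntegral (fun ζ => Complex.exp (quadraticModel N w ζ)) 0 (π / 4) =
      ((1 / √N : ℝ) : ℂ) * (Complex.exp (-I * (w : ℂ) ^ 2) * fresnel w) := by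
  simp only [exp_mul_fresnel, rayIntegral, halfGauss, integral_mul_const,
    quadraticModel_rayPoint_pi_div_four hN.le]
  rw [integral_comp_mul_left_Ioi (fun s : ℝ =>
    Complex.exp (-(s : ℂ) ^ 2 - 2 * (w * antidiagDir) * s)) 0 (Real.sqrt_pos.2 hN), mul_zero,
    Complex.real_smul, one_div, ← diagDir]
  ring

theorem rayIntegral_exp_quadraticModel (hN : 0 < N) (hw : 0 ≤ w) (hφ0 : 0 < φ) (hφ : φ ≤ π / 4) :
    rayIntegral (fun ζ => Complex.exp (quadraticModel N w ζ)) 0 φ =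
      ((1 / √N : ℝ) : ℂ) * (Complex.exp (-I * (w : ℂ) ^ 2) * fresnel w) := by
  have hdiff := (differentiable_quadraticModel N w).cexp
  rw [← rayIntegral_exp_quadraticModel_pi_div_four hN]
  exact rayIntegral_eq_of_exp_decay hφ (mul_pos hN (sin_two_mul_pos hφ0 hφ))
    hdiff.continuous.continuousAt (fun _ _ _ _ => hdiff _)
    (norm_exp_quadraticModel_le hN.le hw hφ0.le)

end QuadraticModel

section Parameters

variable {δ t Lam : ℝ}

theorem rpow_sub_one_mem_Ioo (hδ : δ < 1) (ht : 1 < t) : t ^ (δ - 1) ∈ Ioo (0 : ℝ) 1 :=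
  ⟨Real.rpow_pos_of_pos (by linarith) _, Real.rpow_lt_one_of_one_lt_of_neg ht (by linarith)⟩

theorem lamC_pos (hδ : δ < 1) (ht : 1 < t) : 0 < lamC δ t := by
  obtain ⟨h0, h1⟩ := rpow_sub_one_mem_Ioo hδ ht
  exact div_pos h0 (by linarith)

theorem one_add_lamC (hδ : δ < 1) (ht : 1 < t) : 1 + lamC δ t = 1 / (1 - t ^ (δ - 1)) := by
  have : 1 - t ^ (δ - 1) ≠ 0 := by linarith [(rpow_sub_one_mem_Ioo hδ ht).2]
  rw [lamC]
  field_simp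
  ring

theorem nonneg_of_lamC_le_mul (hδ : δ < 1) (ht : 1 < t) (h : lamC δ t ≤ lamC δ t * (1 + Lam)) :
    0 ≤ Lam := by
  have := (le_mul_iff_one_le_right (lamC_pos hδ ht)).1 h
  linarith

theorem omega_nonneg (hδ : δ < 1) (ht : 1 < t) (hLam : 0 ≤ Lam) : 0 ≤ omega δ t Lam := by
  have := lamC_pos hδ ht
  have := Real.log_nonneg (le_add_of_nonneg_right hLam)
  unfold omega
  positivity

end Parameters

section Angles

variable {lam φ φ₁ φ₂ θ l : ℝ}

theorem AdmissibleAngle.mem_Ioo (h : AdmissibleAngle lam φ) : φ ∈ Ioo 0 (π / 2) := by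
  rcases h with ⟨_, h0, h1⟩ | ⟨_, h0, h1⟩
  · exact ⟨h0, h1⟩
  · exact ⟨h0, h1.trans (Real.arctan_lt_pi_div_two _)⟩

theorem sin_pos_of_mem_Ioo (h : φ ∈ Ioo 0 (π / 2)) : 0 < Real.sin φ :=
  Real.sin_pos_of_pos_of_lt_pi h.1 (by linarith [h.2, Real.pi_pos])

theorem cos_pos_of_mem_Ioo (h : φ ∈ Ioo 0 (π / 2)) : 0 < Real.cos φ :=
  Real.cos_pos_of_mem_Ioo ⟨by linarith [h.1, Real.pi_pos], h.2⟩

theorem AdmissibleAngle.log_mul_sin_add_pos (h : AdmissibleAngle lam φ) :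
    0 < Real.log lam * Real.sin φ + π * Real.cos φ := by
  have hmem := h.mem_Ioo
  have hs := sin_pos_of_mem_Ioo hmem
  have hc := cos_pos_of_mem_Ioo hmem
  rcases h with ⟨hlog, _, _⟩ | ⟨hlog, h0, h1⟩
  · positivity
  · have htan : Real.tan φ < π / |Real.log lam| := by
      simpa only [Real.tan_arctan] using Real.tan_lt_tan_of_lt_of_lt_pi_div_two
        (by linarith [Real.pi_pos]) (Real.arctan_lt_pi_div_two _) h1
    rw [abs_of_neg hlog, Real.tan_eq_sin_div_cos, div_lt_div_iff₀ hc (by linarith)] at htan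
    linarith

theorem AdmissibleAngle.of_mem_Icc (h1 : AdmissibleAngle lam φ₁) (h2 : AdmissibleAngle lam φ₂)
    (h : θ ∈ Icc φ₁ φ₂) : AdmissibleAngle lam θ := by
  have h0 := h1.mem_Ioo.1.trans_le h.1
  rcases h2 with ⟨hlog, _, h3⟩ | ⟨hlog, _, h3⟩
  · exact Or.inl ⟨hlog, h0, h.2.trans_lt h3⟩
  · exact Or.inr ⟨hlog, h0, h.2.trans_lt h3⟩

theorem AdmissibleAngle.exists_pos_le (h1 : AdmissibleAngle lam φ₁) (h2 : AdmissibleAngle lam φ₂) :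
    ∃ m : ℝ, 0 < m ∧ ∀ θ ∈ Icc φ₁ φ₂, m ≤ Real.log lam * Real.sin θ + π * Real.cos θ :=
  isCompact_Icc.exists_forall_le' (by fun_prop) fun _ hθ =>
    (h1.of_mem_Icc h2 hθ).log_mul_sin_add_pos

/-- A direction along which the quadratic part of the phase keeps controlling it far from the saddle
point, for every `λ ≥ l`: in effect `0 < tan φ ≤ 1 / (4 |log l|)`. The contours are rotated to such
a direction before they are estimated. -/
structure DescentAngle (l φ : ℝ) : Prop where
  pos : 0 < φ
  le_pi_div_four : φ ≤ π / 4
  sin_mul_neg_log_le : Real.sin φ * -Real.log l ≤ Real.cos φ / 4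

namespace DescentAngle

theorem mem_Ioo (h : DescentAngle l φ) : φ ∈ Ioo 0 (π / 2) :=
  ⟨h.pos, by linarith [h.le_pi_div_four, Real.pi_pos]⟩

theorem sin_pos (h : DescentAngle l φ) : 0 < Real.sin φ := sin_pos_of_mem_Ioo h.mem_Ioo

theorem cos_pos (h : DescentAngle l φ) : 0 < Real.cos φ := cos_pos_of_mem_Ioo h.mem_Ioo

theorem half_le_cos (h : DescentAngle l φ) : 1 / 2 ≤ Real.cos φ := by
  rw [← Real.cos_pi_div_three]
  exact Real.cos_le_cos_of_nonneg_of_le_pi h.pos.le (by linarith [Real.pi_pos])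
    (by linarith [h.le_pi_div_four, Real.pi_pos])

theorem sin_le_cos (h : DescentAngle l φ) : Real.sin φ ≤ Real.cos φ := by
  rw [← Real.sin_pi_div_two_sub]
  exact Real.sin_le_sin_of_le_of_le_pi_div_two (by linarith [h.pos, Real.pi_pos])
    (by linarith [h.pos]) (by linarith [h.le_pi_div_four])

theorem admissibleAngle (h : DescentAngle l φ) (hl : 0 < l) (hlam : l ≤ lam) :
    AdmissibleAngle lam φ := by
  rcases le_or_gt 0 (Real.log lam) with hlog | hlog
  · exact Or.inl ⟨hlog, h.mem_Ioo⟩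
  · refine Or.inr ⟨hlog, h.pos, ?_⟩
    have hlog' : -Real.log lam ≤ -Real.log l := neg_le_neg (Real.log_le_log hl hlam)
    have hslope := mul_le_mul_of_nonneg_left hlog' h.sin_pos.le
    rw [← Real.arctan_tan (by linarith [h.pos, Real.pi_pos]) h.mem_Ioo.2,
      Real.arctan_lt_arctan_iff, abs_of_neg hlog, Real.tan_eq_sin_div_cos,
      div_lt_div_iff₀ h.cos_pos (by linarith)]
    nlinarith [h.sin_mul_neg_log_le, h.cos_pos, Real.pi_gt_three]

end DescentAngle

theorem exists_descentAngle (hl0 : 0 < l) (hl : l ≤ Real.exp (-1)) :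
    ∃ φ, DescentAngle l φ ∧ 1 / (8 * -Real.log l) ≤ Real.sin φ := by
  have hlog : 1 ≤ -Real.log l := by
    have := Real.log_le_log hl0 hl
    rw [Real.log_exp] at this
    linarith
  obtain ⟨x, hx⟩ : ∃ x, x = 1 / (4 * -Real.log l) := ⟨_, rfl⟩
  have hx0 : 0 < x := hx ▸ by positivity
  have hx1 : x ≤ 1 := hx ▸ (div_le_one (by linarith)).2 (by linarith)
  have hsin : Real.sin (Real.arctan x) = x * Real.cos (Real.arctan x) := by
    rw [Real.sin_arctan, Real.cos_arctan, mul_one_div]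
  have hdesc : DescentAngle l (Real.arctan x) := by
    refine ⟨Real.arctan_pos.2 hx0, ?_, ?_⟩
    · rw [← Real.arctan_one]
      exact Real.arctan_strictMono.monotone hx1
    · have hxlog : x * -Real.log l = 1 / 4 := by
        rw [hx, one_div_mul_eq_div, div_mul_cancel_right₀ (by linarith)]
        norm_num
      rw [hsin, mul_right_comm, hxlog]
      linarith
  refine ⟨Real.arctan x, hdesc, ?_⟩
  calc 1 / (8 * -Real.log l) = x * (1 / 2) := by
        rw [hx]
        field_simp
        norm_num
    _ ≤ Real.sin (Real.arctan x) := by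
        rw [hsin]
        exact mul_le_mul_of_nonneg_left hdesc.half_le_cos hx0.le

end Angles

section PhaseAtInfinity

variable {lc Lam φ₁ φ₂ θ r : ℝ} {ζ : ℂ}

theorem arg_mem_Ioo_of_im_pos {z : ℂ} (hz : 0 < z.im) : z.arg ∈ Ioo 0 π :=
  ⟨(Complex.arg_nonneg_iff.2 hz.le).lt_of_ne fun h => hz.ne' (Complex.arg_eq_zero_iff.1 h.symm).2,
    Complex.arg_lt_pi_iff.2 (Or.inr hz.ne')⟩

theorem log_div_of_im_pos {z w : ℂ} (hz : 0 < z.im) (hw : 0 < w.im) :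
    Complex.log (z / w) = Complex.log z - Complex.log w := by
  have hz0 : z ≠ 0 := fun h => by simp [h] at hz
  have hw0 : w ≠ 0 := fun h => by simp [h] at hw
  have harg_z := arg_mem_Ioo_of_im_pos hz
  have harg_w := arg_mem_Ioo_of_im_pos hw
  rw [← Complex.log_exp (x := Complex.log z - Complex.log w), Complex.exp_sub,
    Complex.exp_log hz0, Complex.exp_log hw0]
  · rw [Complex.sub_im, Complex.log_im, Complex.log_im]
    linarith [harg_z.1, harg_w.2]
  · rw [Complex.sub_im, Complex.log_im, Complex.log_im]
    linarith [harg_z.2, harg_w.1]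

theorem log_neg_of_im_pos {z : ℂ} (hz : 0 < z.im) : Complex.log (-z) = Complex.log z - π * I := by
  apply Complex.ext
  · simp [Complex.log_re]
  · simp [Complex.log_im, Complex.arg_neg_eq_arg_sub_pi_of_im_pos hz]

theorem f1_eq_of_im_pos (hlc : 0 < lc) (hLam : -1 < Lam) (hζ : 0 < ζ.im) :
    f1 lc Lam ζ = lc * (ζ * ((Real.log (lc * (1 + Lam)) + π * I) +
        (Complex.log ((1 + lc * ζ) / (ζ - 1)) - Real.log lc)))
      + Complex.log (1 + lc * ζ) + lc * Complex.log (1 - ζ) := by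
  have hlog : Real.log (lc * (1 + Lam)) = Real.log lc + Real.log (1 + Lam) :=
    Real.log_mul hlc.ne' (by linarith)
  have him : 0 < (ζ - 1).im := by simpa using hζ
  have hquot := log_div_of_im_pos (z := 1 + lc * ζ) (by simpa using mul_pos hlc hζ) him
  have hneg := log_neg_of_im_pos him
  rw [neg_sub] at hneg
  rw [f1, hquot, hneg, hlog]
  push_cast
  ring

theorem tendsto_log_div_sub_one (hlc : 0 < lc) :
    Tendsto (fun ζ : ℂ => Complex.log ((1 + lc * ζ) / (ζ - 1))) (Bornology.cobounded ℂ)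
      (𝓝 (Real.log lc)) := by
  have hinv : Tendsto (fun ζ : ℂ => ζ⁻¹) (Bornology.cobounded ℂ) (𝓝 0) := tendsto_inv₀_cobounded
  have hquot : Tendsto (fun ζ : ℂ => (1 + lc * ζ) / (ζ - 1)) (Bornology.cobounded ℂ)
      (𝓝 (lc : ℂ)) := by
    have := (hinv.add_const (lc : ℂ)).div (tendsto_const_nhds.sub hinv) (b := (1 - 0 : ℂ)) (by simp)
    rw [zero_add, sub_zero, div_one] at this
    refine this.congr' ?_
    filter_upwards [Bornology.eventually_ne_cobounded (0 : ℂ)] with ζ hζ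
    rw [Pi.div_apply, ← mul_div_mul_left _ _ hζ]
    congr 1 <;> field_simp
  rw [Complex.ofReal_log hlc.le]
  exact (continuousAt_clog (Complex.ofReal_mem_slitPlane.2 hlc)).tendsto.comp hquot

theorem eventually_forall_rayPoint {p : ℂ → Prop} (hp : ∀ᶠ ζ in Bornology.cobounded ℂ, p ζ) :
    ∀ᶠ r in atTop, ∀ θ, p (rayPoint 0 θ r) := by
  obtain ⟨R, -, hR⟩ := hasBasis_cobounded_norm.eventually_iff.1 hp
  filter_upwards [eventually_ge_atTop R, eventually_ge_atTop 0] with r hr hr0 θ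
  exact hR (hr.trans_eq (norm_rayPoint_zero θ hr0).symm)

theorem le_im_f1_rayPoint (hlc : 0 < lc) (hLam : -1 < Lam) (hθ : 0 < Real.sin θ) (hr : 0 < r) :
    lc * (r * (Real.log (lc * (1 + Lam)) * Real.sin θ + π * Real.cos θ -
        ‖Complex.log ((1 + lc * rayPoint 0 θ r) / (rayPoint 0 θ r - 1)) - Real.log lc‖))
      - π * (1 + lc) ≤ (f1 lc Lam (rayPoint 0 θ r)).im := by
  have hre := rayPoint_zero_re θ r
  have him := rayPoint_zero_im θ r
  have hnorm := norm_rayPoint_zero θ hr.le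
  rw [f1_eq_of_im_pos hlc hLam (by rw [him]; positivity)]
  generalize rayPoint 0 θ r = ζ at *
  generalize Complex.log ((1 + lc * ζ) / (ζ - 1)) - Real.log lc = e
  have hmain : (ζ * (Real.log (lc * (1 + Lam)) + π * I)).im =
      r * (Real.log (lc * (1 + Lam)) * Real.sin θ + π * Real.cos θ) := by
    simp [hre, him]
    ring
  have herr : -(r * ‖e‖) ≤ (ζ * e).im := by
    rw [← hnorm, ← norm_mul]
    exact (abs_le.1 (Complex.abs_im_le_norm _)).1
  have harg := (Complex.neg_pi_lt_arg (1 + lc * ζ)).le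
  have harg' := mul_le_mul_of_nonneg_left (Complex.neg_pi_lt_arg (1 - ζ)).le hlc.le
  have hprod := mul_le_mul_of_nonneg_left (add_le_add_right herr (r * (Real.log (lc * (1 + Lam)) *
    Real.sin θ + π * Real.cos θ))) hlc.le
  rw [mul_add ζ, Complex.add_im, Complex.add_im, Complex.im_ofReal_mul, Complex.im_ofReal_mul,
    Complex.add_im, hmain, Complex.log_im, Complex.log_im]
  linarith

theorem AdmissibleAngle.exists_mul_le_im_f1 (hlc : 0 < lc) (hLam : -1 < Lam)
    (h1 : AdmissibleAngle (lc * (1 + Lam)) φ₁) (h2 : AdmissibleAngle (lc * (1 + Lam)) φ₂) :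
    ∃ c, 0 < c ∧ ∀ᶠ r in atTop, ∀ θ ∈ Icc φ₁ φ₂, c * r ≤ (f1 lc Lam (rayPoint 0 θ r)).im := by
  obtain ⟨m, hm, hle⟩ := h1.exists_pos_le h2
  have hclose := eventually_forall_rayPoint
    ((tendsto_log_div_sub_one hlc).eventually (Metric.closedBall_mem_nhds _ (half_pos hm)))
  refine ⟨lc * (m / 4), by positivity, ?_⟩
  filter_upwards [hclose, eventually_gt_atTop 0,
    eventually_ge_atTop (π * (1 + lc) / (lc * (m / 4)))] with r hclose hr hr_large θ hθ
  rw [div_le_iff₀ (by positivity)] at hr_large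
  refine le_trans ?_ (le_im_f1_rayPoint hlc hLam
    (sin_pos_of_mem_Ioo (h1.of_mem_Icc h2 hθ).mem_Ioo) hr)
  have herr := mem_closedBall_iff_norm.1 (hclose θ)
  have hprod := mul_le_mul_of_nonneg_left (sub_le_sub (hle θ hθ) herr) (mul_pos hlc hr).le
  linarith

end PhaseAtInfinity

section ReducedIntegral

variable {δ σ t Lam θ φ₁ φ₂ r : ℝ}

theorem sin_le_norm_one_sub_rayPoint (θ r : ℝ) : Real.sin θ ≤ ‖1 - rayPoint 0 θ r‖ := by
  refine Real.le_sqrt_of_sq_le ?_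
  rw [Complex.normSq_apply, Complex.sub_re, Complex.sub_im, rayPoint_zero_re, rayPoint_zero_im,
    Complex.one_re, Complex.one_im]
  nlinarith [Real.sin_sq_add_cos_sq θ, sq_nonneg (r - Real.cos θ)]

theorem one_le_norm_one_add_mul_rayPoint {a : ℝ} (ha : 0 ≤ a) (hc : 0 ≤ Real.cos θ) (hr : 0 ≤ r) :
    1 ≤ ‖1 + (a : ℂ) * rayPoint 0 θ r‖ := by
  refine le_trans ?_ (Complex.re_le_norm _)
  rw [Complex.add_re, Complex.re_ofReal_mul, rayPoint_zero_re, Complex.one_re]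
  exact le_add_of_nonneg_right (by positivity)

theorem norm_one_add_mul_rayPoint_le {a : ℝ} (ha : 0 ≤ a) (hr : 0 ≤ r) :
    ‖1 + (a : ℂ) * rayPoint 0 θ r‖ ≤ 1 + a * r := by
  refine (norm_add_le _ _).trans_eq ?_
  rw [norm_one, norm_mul, norm_rayPoint_zero θ hr, Complex.norm_of_nonneg ha]

theorem one_sub_rayPoint_mem_slitPlane (hs : 0 < Real.sin θ) (hr : 0 ≤ r) :
    1 - rayPoint 0 θ r ∈ Complex.slitPlane := by
  rcases hr.eq_or_lt with rfl | hr
  · simp [rayPoint]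
  · refine Or.inr ?_
    rw [Complex.sub_im, rayPoint_zero_im, Complex.one_im, zero_sub, neg_ne_zero]
    positivity

theorem one_add_mul_rayPoint_mem_slitPlane {a : ℝ} (ha : 0 ≤ a) (hc : 0 ≤ Real.cos θ)
    (hr : 0 ≤ r) : 1 + (a : ℂ) * rayPoint 0 θ r ∈ Complex.slitPlane := by
  refine Or.inl ?_
  rw [Complex.add_re, Complex.re_ofReal_mul, rayPoint_zero_re, Complex.one_re]
  positivity

theorem norm_ampG_le {k : ℕ} (hk : |σ - 1 / 2| ≤ k) (hlc : 0 ≤ lamC δ t) (hs : 0 < Real.sin θ)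
    (hc : 0 ≤ Real.cos θ) (hr : 0 ≤ r) :
    ‖ampG δ σ t (rayPoint 0 θ r)‖ ≤ 1 / Real.sin θ * (1 + lamC δ t * r) ^ k := by
  have hhalf : (-(1 / 2) : ℂ) = ((-(1 / 2) : ℝ) : ℂ) := by push_cast; rfl
  have hσ : ((σ : ℂ) - 1 / 2) = ((σ - 1 / 2 : ℝ) : ℂ) := by push_cast; rfl
  have hbase := one_le_norm_one_add_mul_rayPoint hlc hc hr
  rw [ampG, norm_mul, hhalf, hσ, Complex.norm_cpow_real, Complex.norm_cpow_real]
  refine mul_le_mul ?_ ?_ (by positivity) (by positivity)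
  · calc ‖1 - rayPoint 0 θ r‖ ^ (-(1 / 2) : ℝ)
        ≤ Real.sin θ ^ (-(1 / 2) : ℝ) :=
          Real.rpow_le_rpow_of_nonpos hs (sin_le_norm_one_sub_rayPoint θ r) (by norm_num)
      _ ≤ Real.sin θ ^ (-1 : ℝ) :=
          Real.rpow_le_rpow_of_exponent_ge hs (Real.sin_le_one θ) (by norm_num)
      _ = 1 / Real.sin θ := by rw [Real.rpow_neg_one, one_div]
  · calc ‖1 + (lamC δ t : ℂ) * rayPoint 0 θ r‖ ^ (σ - 1 / 2)
        ≤ ‖1 + (lamC δ t : ℂ) * rayPoint 0 θ r‖ ^ (k : ℝ) :=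
          Real.rpow_le_rpow_of_exponent_le hbase ((le_abs_self _).trans hk)
      _ = ‖1 + (lamC δ t : ℂ) * rayPoint 0 θ r‖ ^ k := Real.rpow_natCast _ _
      _ ≤ (1 + lamC δ t * r) ^ k :=
          pow_le_pow_left₀ (norm_nonneg _) (norm_one_add_mul_rayPoint_le hlc hr) k

theorem re_I_mul_phaseH (δ t Lam : ℝ) (ζ : ℂ) :
    (I * t * phaseH δ t Lam ζ).re = -(t / (1 + lamC δ t) * (f1 (lamC δ t) Lam ζ).im) := by
  have hreal : I * t * phaseH δ t Lam ζ =
      ((t / (1 + lamC δ t) : ℝ) : ℂ) * (I * f1 (lamC δ t) Lam ζ) := by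
    rw [phaseH]
    push_cast
    ring
  rw [hreal, Complex.re_ofReal_mul, Complex.I_mul_re, mul_neg]

theorem differentiableAt_integrandTilde {ζ : ℂ} (hsub : 1 - ζ ∈ Complex.slitPlane)
    (hadd : 1 + (lamC δ t : ℂ) * ζ ∈ Complex.slitPlane) :
    DifferentiableAt ℂ (integrandTilde δ σ t Lam) ζ := by
  have hdsub : DifferentiableAt ℂ (fun z : ℂ => 1 - z) ζ := by fun_prop
  have hdadd : DifferentiableAt ℂ (fun z : ℂ => 1 + (lamC δ t : ℂ) * z) ζ := by fun_prop
  have := hdsub.clog hsub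
  have := hdadd.clog hadd
  unfold integrandTilde ampG phaseH f1
  refine ((hdsub.cpow (differentiableAt_const _) hsub).mul
    (hdadd.cpow (differentiableAt_const _) hadd)).mul ?_
  fun_prop

theorem differentiableAt_integrandTilde_rayPoint (hlc : 0 ≤ lamC δ t) (hθ : θ ∈ Ioo 0 (π / 2))
    (hr : 0 ≤ r) : DifferentiableAt ℂ (integrandTilde δ σ t Lam) (rayPoint 0 θ r) :=
  differentiableAt_integrandTilde (one_sub_rayPoint_mem_slitPlane (sin_pos_of_mem_Ioo hθ) hr)
    (one_add_mul_rayPoint_mem_slitPlane hlc (cos_pos_of_mem_Ioo hθ).le hr)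

theorem exists_norm_integrandTilde_le (σ : ℝ) (hδ : δ < 1) (ht : 1 < t) (hLam : -1 < Lam)
    (h1 : AdmissibleAngle (lamC δ t * (1 + Lam)) φ₁)
    (h2 : AdmissibleAngle (lamC δ t * (1 + Lam)) φ₂) :
    ∃ K c : ℝ, 0 < c ∧ ∀ᶠ r in atTop, ∀ θ ∈ Icc φ₁ φ₂,
      ‖integrandTilde δ σ t Lam (rayPoint 0 θ r)‖ ≤ K * Real.exp (-c * r) := by
  have hlc := lamC_pos hδ ht
  obtain ⟨k, hk⟩ := exists_nat_ge |σ - 1 / 2|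
  obtain ⟨c, hc, hphase⟩ := h1.exists_mul_le_im_f1 hlc hLam h2
  obtain ⟨κ, hκ⟩ : ∃ κ, κ = t / (1 + lamC δ t) * c / 2 := ⟨_, rfl⟩
  have hκ0 : 0 < κ := hκ ▸ by positivity
  have hsin1 := sin_pos_of_mem_Ioo h1.mem_Ioo
  refine ⟨1 / Real.sin φ₁ * (k.factorial / (κ / lamC δ t) ^ k * Real.exp (κ / lamC δ t)), κ, hκ0,
    ?_⟩
  filter_upwards [hphase, eventually_ge_atTop 0] with r hphase hr θ hθ
  have hmem := (h1.of_mem_Icc h2 hθ).mem_Ioo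
  have hsin : Real.sin φ₁ ≤ Real.sin θ := Real.sin_le_sin_of_le_of_le_pi_div_two
    (by linarith [h1.mem_Ioo.1, Real.pi_pos]) hmem.2.le hθ.1
  have hamp : ‖ampG δ σ t (rayPoint 0 θ r)‖ ≤ 1 / Real.sin φ₁ *
      (k.factorial / (κ / lamC δ t) ^ k * Real.exp (κ / lamC δ t) * Real.exp (κ * r)) := by
    have hpow := one_add_pow_le_mul_exp k (div_pos hκ0 hlc) (mul_nonneg hlc.le hr)
    rw [← mul_assoc (κ / lamC δ t), div_mul_cancel₀ _ hlc.ne'] at hpow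
    refine (norm_ampG_le hk hlc.le (sin_pos_of_mem_Ioo hmem) (cos_pos_of_mem_Ioo hmem).le hr).trans
      (mul_le_mul ?_ hpow (by positivity) (by positivity))
    exact one_div_le_one_div_of_le hsin1 hsin
  have hexp : (I * t * phaseH δ t Lam (rayPoint 0 θ r)).re ≤ -(κ * r) - κ * r := by
    have hscaled := mul_le_mul_of_nonneg_left (hphase θ hθ)
      (show 0 ≤ t / (1 + lamC δ t) by positivity)
    rw [re_I_mul_phaseH]
    linear_combination hscaled + 2 * r * hκ
  rw [integrandTilde, norm_mul, Complex.norm_exp]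
  refine (mul_le_mul hamp (Real.exp_le_exp.2 hexp) (by positivity) (by positivity)).trans_eq ?_
  rw [Real.exp_sub, ← neg_mul]
  field_simp

theorem rayIntegrable_integrandTilde (σ : ℝ) (hδ : δ < 1) (ht : 1 < t) (hLam : -1 < Lam)
    (hθ : AdmissibleAngle (lamC δ t * (1 + Lam)) θ) :
    RayIntegrable (integrandTilde δ σ t Lam) 0 θ := by
  obtain ⟨K, c, hc, hK⟩ := exists_norm_integrandTilde_le σ hδ ht hLam hθ hθ
  exact rayIntegrable_of_exp_decay hc (fun r hr => (differentiableAt_integrandTilde_rayPoint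
    (lamC_pos hδ ht).le hθ.mem_Ioo hr).continuousAt) (hK.mono fun r hr => hr θ ⟨le_rfl, le_rfl⟩)

theorem JBtilde_eq_of_admissibleAngle (σ : ℝ) (hδ : δ < 1) (ht : 1 < t) (hLam : -1 < Lam)
    (h1 : AdmissibleAngle (lamC δ t * (1 + Lam)) φ₁)
    (h2 : AdmissibleAngle (lamC δ t * (1 + Lam)) φ₂) :
    JBtilde δ σ t Lam φ₁ = JBtilde δ σ t Lam φ₂ := by
  wlog h12 : φ₁ ≤ φ₂ generalizing φ₁ φ₂
  · exact (this h2 h1 (le_of_not_ge h12)).symm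
  obtain ⟨K, c, hc, hK⟩ := exists_norm_integrandTilde_le σ hδ ht hLam h1 h2
  refine rayIntegral_eq_of_exp_decay h12 hc ?_ (fun r hr θ hθ => ?_) hK
  · exact (differentiableAt_integrandTilde (by simp) (by simp)).continuousAt
  · exact differentiableAt_integrandTilde_rayPoint (lamC_pos hδ ht).le
      (h1.of_mem_Icc h2 hθ).mem_Ioo hr.le

end ReducedIntegral

section Scaling

variable {f g : ℂ → ℂ} {a b C : ℂ} {c φ : ℝ}

theorem rayIntegrable_of_comp_mul (hc : 0 < c)
    (hfg : ∀ r, 0 < r → c * f (rayPoint a φ (c * r)) = C * g (rayPoint b φ r))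
    (hg : RayIntegrable g b φ) : RayIntegrable f a φ := by
  have hcC : (c : ℂ) ≠ 0 := Complex.ofReal_ne_zero.2 hc.ne'
  have hscale := integrableOn_Ioi_comp_mul_left_iff
    (fun r => f (rayPoint a φ r) * Complex.exp (I * φ)) 0 hc
  rw [mul_zero] at hscale
  refine hscale.1 (IntegrableOn.congr_fun (hg.const_mul ((c : ℂ)⁻¹ * C)) (fun r hr => ?_)
    measurableSet_Ioi)
  rw [mul_assoc, ← mul_assoc C, ← hfg r hr, mul_assoc (c : ℂ), inv_mul_cancel_left₀ hcC]

theorem rayIntegral_eq_mul_of_comp_mul (hc : 0 < c)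
    (hfg : ∀ r, 0 < r → c * f (rayPoint a φ (c * r)) = C * g (rayPoint b φ r)) :
    rayIntegral f a φ = C * rayIntegral g b φ := by
  have hscale := integral_comp_mul_left_Ioi'
    (fun r => f (rayPoint a φ r) * Complex.exp (I * φ)) 0 hc
  rw [mul_zero] at hscale
  rw [rayIntegral, rayIntegral, ← hscale, Complex.real_smul, ← integral_const_mul,
    ← integral_const_mul]
  refine setIntegral_congr_fun measurableSet_Ioi fun r hr => ?_
  have h := hfg r hr
  linear_combination Complex.exp (I * φ) * h

theorem cpow_ofReal_mul {x : ℝ} (hx : 0 < x) {z : ℂ} (hz : z ≠ 0) (y : ℝ) :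
    ((x : ℂ) * z) ^ (y : ℂ) = ((x ^ y : ℝ) : ℂ) * z ^ (y : ℂ) := by
  rw [Complex.cpow_def_of_ne_zero (mul_ne_zero (Complex.ofReal_ne_zero.2 hx.ne') hz),
    Complex.cpow_def_of_ne_zero hz, Complex.log_ofReal_mul hx hz, Real.rpow_def_of_pos hx,
    add_mul, Complex.exp_add]
  push_cast
  rfl

end Scaling

section ChangeOfVariables

variable {δ σ t Lam φ r : ℝ} {ζ : ℂ}

theorem one_sub_mul_lamC (hδ : δ < 1) (ht : 1 < t) :
    (1 - t ^ (δ - 1)) * lamC δ t = t ^ (δ - 1) :=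
  mul_div_cancel₀ _ (by linarith [(rpow_sub_one_mem_Ioo hδ ht).2])

theorem one_div_one_add_lamC (hδ : δ < 1) (ht : 1 < t) :
    1 / (1 + lamC δ t) = 1 - t ^ (δ - 1) := by
  rw [one_add_lamC hδ ht, one_div_one_div]

theorem lamC_div_one_add_lamC (hδ : δ < 1) (ht : 1 < t) :
    lamC δ t / (1 + lamC δ t) = t ^ (δ - 1) := by
  rw [div_eq_mul_one_div, one_div_one_add_lamC hδ ht, mul_comm, one_sub_mul_lamC hδ ht]

theorem log_lamC (hδ : δ < 1) (ht : 1 < t) :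
    Real.log (lamC δ t) = Real.log (t ^ (δ - 1)) - Real.log (1 - t ^ (δ - 1)) := by
  obtain ⟨h0, h1⟩ := rpow_sub_one_mem_Ioo hδ ht
  exact Real.log_div h0.ne' (by linarith)

theorem f0_lamC_eq (hδ : δ < 1) (ht : 1 < t) (hLam : -1 < Lam) :
    f0 Lam (lamC δ t) = (1 + lamC δ t) * Real.log (t ^ (δ - 1)) + Real.log (1 + Lam) := by
  have hs := (rpow_sub_one_mem_Ioo hδ ht).1
  have hinv : (1 + lamC δ t) / lamC δ t = (t ^ (δ - 1))⁻¹ := by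
    rw [← lamC_div_one_add_lamC hδ ht, inv_div]
  rw [f0, mul_div_right_comm, lamC_div_one_add_lamC hδ ht, hinv, Real.log_inv,
    Real.log_mul hs.ne' (by linarith)]
  ring

theorem rayPoint_eq_one_sub_mul (hδ : δ < 1) (ht : 1 < t) (φ r : ℝ) :
    rayPoint ((1 - t ^ (δ - 1) : ℝ) : ℂ) φ (t ^ (δ - 1) * r) =
      ((1 - t ^ (δ - 1) : ℝ) : ℂ) * (1 + lamC δ t * rayPoint 0 φ r) := by
  have h : ((1 - t ^ (δ - 1) : ℝ) : ℂ) * lamC δ t = (t ^ (δ - 1) : ℝ) :=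
    mod_cast one_sub_mul_lamC hδ ht
  rw [rayPoint_zero_eq, rayPoint, Complex.ofReal_mul]
  linear_combination (-(r : ℂ) * Complex.exp (I * φ)) * h

theorem one_sub_one_sub_mul (hδ : δ < 1) (ht : 1 < t) (ζ : ℂ) :
    1 - ((1 - t ^ (δ - 1) : ℝ) : ℂ) * (1 + lamC δ t * ζ) =
      ((t ^ (δ - 1) : ℝ) : ℂ) * (1 - ζ) := by
  have h : ((1 - t ^ (δ - 1) : ℝ) : ℂ) * lamC δ t = (t ^ (δ - 1) : ℝ) :=
    mod_cast one_sub_mul_lamC hδ ht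
  rw [mul_add, ← mul_assoc, h]
  push_cast
  ring

theorem phaseF_one_sub_mul (hδ : δ < 1) (ht : 1 < t) (hLam : -1 < Lam) (hsub : 1 - ζ ≠ 0)
    (hadd : 1 + (lamC δ t : ℂ) * ζ ≠ 0) :
    phaseF (lamC δ t * (1 + Lam)) (((1 - t ^ (δ - 1) : ℝ) : ℂ) * (1 + lamC δ t * ζ)) =
      f0 Lam (lamC δ t) / (1 + lamC δ t) + phaseH δ t Lam ζ := by
  obtain ⟨hs0, hs1⟩ := rpow_sub_one_mem_Ioo hδ ht
  have hinv : ((1 : ℂ) + lamC δ t)⁻¹ = 1 - (t ^ (δ - 1) : ℝ) := by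
    rw [← one_div]
    exact_mod_cast one_div_one_add_lamC hδ ht
  have hlc : (1 - ((t ^ (δ - 1) : ℝ) : ℂ)) * lamC δ t = (t ^ (δ - 1) : ℝ) :=
    mod_cast one_sub_mul_lamC hδ ht
  rw [phaseF, one_sub_one_sub_mul hδ ht, Complex.log_ofReal_mul hs0 hsub,
    Complex.log_ofReal_mul (by linarith) hadd,
    Real.log_mul (lamC_pos hδ ht).ne' (by linarith), log_lamC hδ ht, phaseH, f1,
    f0_lamC_eq hδ ht hLam, div_eq_mul_inv, div_eq_mul_inv, hinv]
  generalize t ^ (δ - 1) = s at *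
  push_cast
  linear_combination (-((1 - ζ) * ((Real.log s : ℂ) + Complex.log (1 - ζ)))) * hlc

theorem amplitude_one_sub_mul (hδ : δ < 1) (ht : 1 < t) (hsub : 1 - ζ ≠ 0)
    (hadd : 1 + (lamC δ t : ℂ) * ζ ≠ 0) :
    ((t ^ (δ - 1) : ℝ) : ℂ) *
        ((1 - ((1 - t ^ (δ - 1) : ℝ) : ℂ) * (1 + lamC δ t * ζ)) ^ (-(1 / 2) : ℂ) *
          (((1 - t ^ (δ - 1) : ℝ) : ℂ) * (1 + lamC δ t * ζ)) ^ ((σ : ℂ) - 1 / 2)) =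
      (((lamC δ t / (1 + lamC δ t)) ^ (1 / 2 : ℝ) * (1 / (1 + lamC δ t)) ^ (σ - 1 / 2) : ℝ) : ℂ) *
        ampG δ σ t ζ := by
  obtain ⟨hs0, hs1⟩ := rpow_sub_one_mem_Ioo hδ ht
  have hhalf : (-(1 / 2) : ℂ) = ((-(1 / 2) : ℝ) : ℂ) := by push_cast; rfl
  have hσ : ((σ : ℂ) - 1 / 2) = ((σ - 1 / 2 : ℝ) : ℂ) := by push_cast; rfl
  have hpow (s : ℝ) (hs : 0 < s) : s ^ (1 / 2 : ℝ) = s * s ^ (-(1 / 2) : ℝ) := by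
    rw [← Real.rpow_one_add' hs.le (by norm_num)]
    norm_num
  rw [ampG, one_sub_one_sub_mul hδ ht, hhalf, hσ, cpow_ofReal_mul hs0 hsub,
    cpow_ofReal_mul (by linarith) hadd, lamC_div_one_add_lamC hδ ht, one_div_one_add_lamC hδ ht,
    hpow _ hs0]
  push_cast
  ring

theorem mul_integrandJB_rayPoint (σ : ℝ) (hδ : δ < 1) (ht : 1 < t) (hLam : -1 < Lam)
    (hφ : φ ∈ Ioo 0 (π / 2)) (hr : 0 ≤ r) :
    ((t ^ (δ - 1) : ℝ) : ℂ) * integrandJB σ t (lamC δ t * (1 + Lam))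
        (rayPoint ((1 - t ^ (δ - 1) : ℝ) : ℂ) φ (t ^ (δ - 1) * r)) =
      prefactor δ σ t Lam * integrandTilde δ σ t Lam (rayPoint 0 φ r) := by
  have hsub := Complex.slitPlane_ne_zero
    (one_sub_rayPoint_mem_slitPlane (sin_pos_of_mem_Ioo hφ) hr)
  have hadd := Complex.slitPlane_ne_zero (one_add_mul_rayPoint_mem_slitPlane (lamC_pos hδ ht).le
    (cos_pos_of_mem_Ioo hφ).le hr)
  rw [rayPoint_eq_one_sub_mul hδ ht, integrandJB, ← mul_assoc,
    amplitude_one_sub_mul hδ ht hsub hadd, phaseF_one_sub_mul hδ ht hLam hsub hadd, mul_add,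
    Complex.exp_add, prefactor, integrandTilde, mul_div_assoc]
  ring

theorem rayIntegrable_integrandJB (σ : ℝ) (hδ : δ < 1) (ht : 1 < t) (hLam : -1 < Lam)
    (hφ : AdmissibleAngle (lamC δ t * (1 + Lam)) φ) :
    RayIntegrable (integrandJB σ t (lamC δ t * (1 + Lam))) ((1 - t ^ (δ - 1) : ℝ) : ℂ) φ :=
  rayIntegrable_of_comp_mul (rpow_sub_one_mem_Ioo hδ ht).1
    (fun _ hr => mul_integrandJB_rayPoint σ hδ ht hLam hφ.mem_Ioo hr.le)
    (rayIntegrable_integrandTilde σ hδ ht hLam hφ)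

theorem JB_eq_prefactor_mul (σ : ℝ) (hδ : δ < 1) (ht : 1 < t) (hLam : -1 < Lam)
    (hφ : φ ∈ Ioo 0 (π / 2)) :
    JB δ σ t (lamC δ t * (1 + Lam)) φ = prefactor δ σ t Lam * JBtilde δ σ t Lam φ :=
  rayIntegral_eq_mul_of_comp_mul (rpow_sub_one_mem_Ioo hδ ht).1
    fun _ hr => mul_integrandJB_rayPoint σ hδ ht hLam hφ hr.le

end ChangeOfVariables

section PhaseGrowth

variable {lc Lam φ r : ℝ} {ζ : ℂ}

theorem hasDerivAt_f1 (hsub : 1 - ζ ∈ Complex.slitPlane)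
    (hadd : 1 + (lc : ℂ) * ζ ∈ Complex.slitPlane) :
    HasDerivAt (f1 lc Lam)
      (lc * (Real.log (1 + Lam) + Complex.log (1 + lc * ζ) - Complex.log (1 - ζ))) ζ := by
  have hdmul : HasDerivAt (fun z : ℂ => (lc : ℂ) * z) lc ζ := by
    simpa using (hasDerivAt_id ζ).const_mul (lc : ℂ)
  have hlogsub := ((hasDerivAt_id ζ).const_sub 1).clog hsub
  have hlogadd := (hdmul.const_add 1).clog hadd
  have hsub0 := Complex.slitPlane_ne_zero hsub
  have hadd0 := Complex.slitPlane_ne_zero hadd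
  refine (((hdmul.mul ((hlogadd.const_add (Real.log (1 + Lam) : ℂ)).sub hlogsub)).add hlogadd).add
    (hlogsub.const_mul (lc : ℂ))).congr_deriv ?_
  simp only [Pi.sub_apply, id_eq]
  field_simp
  ring

theorem hasDerivAt_rayPoint (a : ℂ) (φ r : ℝ) :
    HasDerivAt (rayPoint a φ) (Complex.exp (I * φ)) r := by
  have h := ((hasDerivAt_id r).ofReal_comp.mul_const (Complex.exp (I * φ))).const_add a
  exact h.congr_deriv (by rw [Complex.ofReal_one, one_mul])

/-- The derivative of `Im f₁` along the ray of direction `φ`, divided by `λ_c`. -/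
noncomputable def radialSlope (lc Lam φ r : ℝ) : ℝ :=
  Real.sin φ * (Real.log (1 + Lam) + Real.log ‖1 + (lc : ℂ) * rayPoint 0 φ r‖ -
    Real.log ‖1 - rayPoint 0 φ r‖) +
  Real.cos φ * ((1 + (lc : ℂ) * rayPoint 0 φ r).arg - (1 - rayPoint 0 φ r).arg)

theorem hasDerivAt_im_f1 (hlc : 0 ≤ lc) (hφ : φ ∈ Ioo 0 (π / 2)) (hr : 0 ≤ r) :
    HasDerivAt (fun r => (f1 lc Lam (rayPoint 0 φ r)).im) (lc * radialSlope lc Lam φ r) r := by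
  have hsub := one_sub_rayPoint_mem_slitPlane (sin_pos_of_mem_Ioo hφ) hr
  have hadd := one_add_mul_rayPoint_mem_slitPlane hlc (cos_pos_of_mem_Ioo hφ).le hr
  refine (Complex.imCLM.hasFDerivAt.comp_hasDerivAt r
    ((hasDerivAt_f1 (Lam := Lam) hsub hadd).comp r (hasDerivAt_rayPoint 0 φ r))).congr_deriv ?_
  rw [Complex.imCLM_apply, mul_assoc, Complex.im_ofReal_mul, mul_comm I, Complex.mul_im,
    Complex.exp_ofReal_mul_I_re, Complex.exp_ofReal_mul_I_im]
  simp only [Complex.sub_re, Complex.sub_im, Complex.add_re, Complex.add_im, Complex.ofReal_re,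
    Complex.ofReal_im, Complex.log_re, Complex.log_im, radialSlope]
  ring

theorem one_sub_rayPoint_re (φ r : ℝ) : (1 - rayPoint 0 φ r).re = 1 - r * Real.cos φ := by
  rw [Complex.sub_re, rayPoint_zero_re, Complex.one_re]

theorem one_sub_rayPoint_im (φ r : ℝ) : (1 - rayPoint 0 φ r).im = -(r * Real.sin φ) := by
  rw [Complex.sub_im, rayPoint_zero_im, Complex.one_im, zero_sub]

theorem norm_sq_one_sub_rayPoint (φ r : ℝ) :
    ‖1 - rayPoint 0 φ r‖ ^ 2 = 1 - 2 * r * Real.cos φ + r ^ 2 := by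
  rw [← Complex.normSq_eq_norm_sq, Complex.normSq_apply, one_sub_rayPoint_re, one_sub_rayPoint_im]
  linear_combination r ^ 2 * Real.sin_sq_add_cos_sq φ

theorem norm_sq_one_add_mul_rayPoint (a φ r : ℝ) :
    ‖1 + (a : ℂ) * rayPoint 0 φ r‖ ^ 2 = 1 + 2 * a * r * Real.cos φ + a ^ 2 * r ^ 2 := by
  rw [← Complex.normSq_eq_norm_sq, Complex.normSq_apply]
  simp only [Complex.add_re, Complex.add_im, Complex.one_re, Complex.one_im, rayPoint_zero_re,
    rayPoint_zero_im, Complex.re_ofReal_mul, Complex.im_ofReal_mul]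
  linear_combination a ^ 2 * r ^ 2 * Real.sin_sq_add_cos_sq φ

theorem norm_one_sub_rayPoint_le_one (hr : 0 ≤ r) (hrc : r ≤ 2 * Real.cos φ) :
    ‖1 - rayPoint 0 φ r‖ ≤ 1 := by
  refine (sq_le_one_iff₀ (norm_nonneg _)).1 ?_
  rw [norm_sq_one_sub_rayPoint]
  nlinarith

theorem mul_norm_one_sub_rayPoint_le {a : ℝ} (ha : 0 ≤ a) (ha1 : a ≤ 1) (hc : 0 ≤ Real.cos φ)
    (hr : 0 ≤ r) : a * ‖1 - rayPoint 0 φ r‖ ≤ ‖1 + (a : ℂ) * rayPoint 0 φ r‖ := by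
  refine (pow_le_pow_iff_left₀ (by positivity) (norm_nonneg _) two_ne_zero).1 ?_
  rw [mul_pow, norm_sq_one_sub_rayPoint, norm_sq_one_add_mul_rayPoint]
  have hcross : 0 ≤ 2 * a * r * Real.cos φ := by positivity
  have hcross' : 0 ≤ 2 * a ^ 2 * r * Real.cos φ := by positivity
  nlinarith

theorem arg_one_add_mul_rayPoint_nonneg {a : ℝ} (ha : 0 ≤ a) (hs : 0 ≤ Real.sin φ) (hr : 0 ≤ r) :
    0 ≤ (1 + (a : ℂ) * rayPoint 0 φ r).arg := by
  rw [Complex.arg_nonneg_iff, Complex.add_im, Complex.im_ofReal_mul, rayPoint_zero_im,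
    Complex.one_im, zero_add]
  positivity

theorem arg_one_sub_rayPoint_nonpos (hs : 0 < Real.sin φ) (hr : 0 ≤ r) :
    (1 - rayPoint 0 φ r).arg ≤ 0 := by
  rcases hr.eq_or_lt with rfl | hr
  · simp [rayPoint]
  · refine (Complex.arg_neg_iff.2 ?_).le
    rw [one_sub_rayPoint_im]
    exact neg_neg_of_pos (by positivity)

theorem mul_sin_le_neg_arg_one_sub_rayPoint (hs : 0 < Real.sin φ) (hr : 0 ≤ r)
    (hrc : r ≤ 2 * Real.cos φ) : r * Real.sin φ ≤ -(1 - rayPoint 0 φ r).arg := by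
  have hpos : 0 < ‖1 - rayPoint 0 φ r‖ := hs.trans_le (sin_le_norm_one_sub_rayPoint φ r)
  have hsin := Real.sin_le (neg_nonneg.2 (arg_one_sub_rayPoint_nonpos hs hr))
  rw [Real.sin_neg, Complex.sin_arg, one_sub_rayPoint_im, neg_div, neg_neg] at hsin
  refine le_trans ?_ hsin
  rw [le_div_iff₀ hpos]
  exact mul_le_of_le_one_right (by positivity) (norm_one_sub_rayPoint_le_one hr hrc)

theorem arg_le_neg_pi_div_four {z : ℂ} (him : z.im < 0) (hre : z.re ≤ -z.im) :
    z.arg ≤ -(π / 4) := by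
  by_contra! hlt
  have := Real.pi_pos
  have hz : z ≠ 0 := fun h => by simp [h] at him
  have hneg := Complex.arg_neg_iff.2 him
  have hsin : Real.sin (-z.arg) < Real.sin (π / 4) :=
    Real.sin_lt_sin_of_lt_of_le_pi_div_two (by linarith) (by linarith) (by linarith)
  have hcos : Real.cos (π / 4) < Real.cos (-z.arg) :=
    Real.cos_lt_cos_of_nonneg_of_le_pi (by linarith) (by linarith) (by linarith)
  rw [Real.sin_neg, Complex.sin_arg, Real.sin_pi_div_four, ← Real.cos_pi_div_four, ← neg_div]
    at hsin
  rw [Real.cos_neg, Complex.cos_arg hz] at hcos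
  exact hre.not_gt ((div_lt_div_iff_of_pos_right (norm_pos_iff.2 hz)).1 (hsin.trans hcos))

theorem arg_one_sub_rayPoint_le_neg_pi_div_four (hφ : φ ∈ Ioo 0 (π / 2)) (hr : 1 ≤ r) :
    (1 - rayPoint 0 φ r).arg ≤ -(π / 4) := by
  have hs := sin_pos_of_mem_Ioo hφ
  have hc := cos_pos_of_mem_Ioo hφ
  refine arg_le_neg_pi_div_four ?_ ?_
  · rw [one_sub_rayPoint_im]
    exact neg_neg_of_pos (by positivity)
  · have hsum : 1 ≤ Real.sin φ + Real.cos φ := by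
      nlinarith [Real.sin_sq_add_cos_sq φ, mul_pos hs hc]
    rw [one_sub_rayPoint_re, one_sub_rayPoint_im]
    nlinarith

namespace DescentAngle

theorem le_radialSlope_of_le_one (h : DescentAngle lc φ) (hlc : 0 ≤ lc) (hr : r ∈ Icc 0 1) :
    Real.sin φ * Real.log (1 + Lam) + Real.sin φ * r / 2 ≤ radialSlope lc Lam φ r := by
  have hs := h.sin_pos
  have hrc : r ≤ 2 * Real.cos φ := by linarith [hr.2, h.half_le_cos]
  have hlogsub := Real.log_nonpos (norm_nonneg _) (norm_one_sub_rayPoint_le_one hr.1 hrc)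
  have hlogadd := Real.log_nonneg (one_le_norm_one_add_mul_rayPoint hlc h.cos_pos.le hr.1)
  have hlog := mul_nonneg hs.le (sub_nonneg.2 (hlogsub.trans hlogadd))
  have harg := mul_le_mul h.half_le_cos
    (sub_le_sub (arg_one_add_mul_rayPoint_nonneg hlc hs.le hr.1)
      (le_neg.1 (mul_sin_le_neg_arg_one_sub_rayPoint hs hr.1 hrc)))
    (by linarith [mul_nonneg hr.1 hs.le]) h.cos_pos.le
  rw [radialSlope]
  linarith

theorem le_radialSlope_of_one_le (h : DescentAngle lc φ) (hlc : 0 < lc) (hlc1 : lc ≤ 1)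
    (hr : 1 ≤ r) :
    Real.sin φ * Real.log (1 + Lam) + Real.sin φ / 2 ≤ radialSlope lc Lam φ r := by
  have hs := h.sin_pos
  have hpos : 0 < ‖1 - rayPoint 0 φ r‖ := hs.trans_le (sin_le_norm_one_sub_rayPoint φ r)
  have hlog := Real.log_le_log (by positivity)
    (mul_norm_one_sub_rayPoint_le hlc.le hlc1 h.cos_pos.le (zero_le_one.trans hr))
  rw [Real.log_mul hlc.ne' hpos.ne'] at hlog
  have hslope := mul_le_mul_of_nonneg_left hlog hs.le
  have harg := mul_le_mul_of_nonneg_left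
    (sub_le_sub (arg_one_add_mul_rayPoint_nonneg hlc.le hs.le (zero_le_one.trans hr))
      (arg_one_sub_rayPoint_le_neg_pi_div_four h.mem_Ioo hr)) h.cos_pos.le
  have hpi := mul_le_mul_of_nonneg_left Real.pi_gt_three.le h.cos_pos.le
  rw [radialSlope]
  linarith [h.sin_mul_neg_log_le, h.sin_le_cos]

theorem le_im_f1_of_le_one (h : DescentAngle lc φ) (hlc : 0 ≤ lc) (hr : r ∈ Icc 0 1) :
    lc * (Real.sin φ * Real.log (1 + Lam) * r + Real.sin φ * r ^ 2 / 4) ≤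
      (f1 lc Lam (rayPoint 0 φ r)).im := by
  have hderiv (x : ℝ) (hx : 0 ≤ x) : HasDerivAt
      (fun r => (f1 lc Lam (rayPoint 0 φ r)).im -
        lc * (Real.sin φ * Real.log (1 + Lam) * r + Real.sin φ * r ^ 2 / 4))
      (lc * (radialSlope lc Lam φ x -
        (Real.sin φ * Real.log (1 + Lam) + Real.sin φ * x / 2))) x := by
    have hquad := ((hasDerivAt_id x).const_mul (Real.sin φ * Real.log (1 + Lam))).add
      (((hasDerivAt_pow 2 x).const_mul (Real.sin φ)).div_const 4)
    refine ((hasDerivAt_im_f1 hlc h.mem_Ioo hx).sub (hquad.const_mul lc)).congr_deriv ?_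
    push_cast
    ring
  have hmono := monotoneOn_of_deriv_nonneg (convex_Icc (0 : ℝ) 1)
    (fun x hx => (hderiv x hx.1).continuousAt.continuousWithinAt)
    (fun x hx => (hderiv x (interior_subset hx).1).differentiableAt.differentiableWithinAt)
    (fun x hx => by
      rw [(hderiv x (interior_subset hx).1).deriv]
      exact mul_nonneg hlc (sub_nonneg.2 (h.le_radialSlope_of_le_one hlc (interior_subset hx))))
  have hle := hmono (left_mem_Icc.2 zero_le_one) hr hr.1
  simp only [rayPoint, f1, Complex.ofReal_zero, zero_mul, mul_zero, add_zero, sub_zero,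
    Complex.log_one, Complex.zero_im, ne_eq, OfNat.ofNat_ne_zero, not_false_eq_true, zero_pow,
    zero_div] at hle
  exact sub_nonneg.1 hle

theorem le_im_f1_of_one_le (h : DescentAngle lc φ) (hlc : 0 < lc) (hlc1 : lc ≤ 1) (hr : 1 ≤ r) :
    lc * (Real.sin φ * Real.log (1 + Lam) * r + Real.sin φ * r / 4) ≤
      (f1 lc Lam (rayPoint 0 φ r)).im := by
  have hderiv (x : ℝ) (hx : 1 ≤ x) := hasDerivAt_im_f1 (Lam := Lam) hlc.le h.mem_Ioo
    (zero_le_one.trans hx)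
  have hincr := Convex.mul_sub_le_image_sub_of_le_deriv (convex_Ici (1 : ℝ))
    (fun x hx => (hderiv x hx).continuousAt.continuousWithinAt)
    (fun x hx => (hderiv x (interior_subset hx)).differentiableAt.differentiableWithinAt)
    (fun x hx => by
      rw [(hderiv x (interior_subset hx)).deriv]
      exact mul_le_mul_of_nonneg_left (h.le_radialSlope_of_one_le hlc hlc1 (interior_subset hx))
        hlc.le) 1 (mem_Ici.2 le_rfl) r hr hr
  have hone := h.le_im_f1_of_le_one (Lam := Lam) hlc.le (right_mem_Icc.2 zero_le_one)
  have hextra : 0 ≤ lc * Real.sin φ * (r - 1) :=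
    mul_nonneg (mul_pos hlc h.sin_pos).le (by linarith)
  linarith

end DescentAngle

end PhaseGrowth

section LocalExpansion

variable {δ σ t lc Lam : ℝ} {z ζ : ℂ}

theorem norm_exp_sub_exp_le {a b : ℂ} {m : ℝ} (ha : a.re ≤ m) (hb : b.re ≤ m) :
    ‖Complex.exp a - Complex.exp b‖ ≤ Real.exp m * ‖a - b‖ :=
  Convex.norm_image_sub_le_of_norm_deriv_le (𝕜 := ℂ) (s := {z : ℂ | z.re ≤ m})
    (fun z _ => Complex.differentiableAt_exp)
    (fun z hz => by
      rw [Complex.deriv_exp, Complex.norm_exp]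
      exact Real.exp_le_exp.2 hz)
    (convex_halfSpace_re_le m) hb ha

theorem inv_one_sub_norm_le_two (hz : ‖z‖ ≤ 1 / 2) : (1 - ‖z‖)⁻¹ ≤ 2 := by
  rw [inv_le_comm₀ (by linarith) two_pos]
  linarith

theorem norm_log_one_add_sub_le (hz : ‖z‖ ≤ 1 / 2) : ‖Complex.log (1 + z) - z‖ ≤ ‖z‖ ^ 2 := by
  refine (Complex.norm_log_one_add_sub_self_le (by linarith)).trans ?_
  nlinarith [mul_le_mul_of_nonneg_left (inv_one_sub_norm_le_two hz) (sq_nonneg ‖z‖)]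

theorem norm_log_one_add_sub_sub_le (hz : ‖z‖ ≤ 1 / 2) :
    ‖Complex.log (1 + z) - (z - z ^ 2 / 2)‖ ≤ ‖z‖ ^ 3 := by
  have htaylor : Complex.logTaylor (2 + 1) z = z - z ^ 2 / 2 := by
    simp only [Complex.logTaylor, Finset.sum_range_succ, Finset.sum_range_zero]
    norm_num
    ring
  have hbound := Complex.norm_log_sub_logTaylor_le 2 (z := z) (by linarith)
  rw [htaylor] at hbound
  refine hbound.trans ?_
  have hcube := pow_nonneg (norm_nonneg z) 3
  norm_num
  nlinarith [mul_le_mul_of_nonneg_left (inv_one_sub_norm_le_two hz) hcube]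

theorem one_add_ne_zero_of_norm_le_half (hz : ‖z‖ ≤ 1 / 2) : 1 + z ≠ 0 := fun h => by
  rw [eq_neg_of_add_eq_zero_right h, norm_neg, norm_one] at hz
  norm_num at hz

theorem norm_ampG_sub_one_le {k : ℕ} (hk : |σ - 1 / 2| ≤ k) (hlc : 0 ≤ lamC δ t)
    (hlc1 : lamC δ t ≤ 1) (hζ : ‖ζ‖ ≤ 1 / 2) :
    ‖ampG δ σ t ζ - 1‖ ≤ 2 * (1 + k) * Real.exp (1 + k) * ‖ζ‖ := by
  have hk0 : (0 : ℝ) ≤ k := Nat.cast_nonneg k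
  have hmul : ‖(lamC δ t : ℂ) * ζ‖ ≤ ‖ζ‖ := by
    rw [norm_mul, Complex.norm_of_nonneg hlc]
    exact mul_le_of_le_one_left (norm_nonneg ζ) hlc1
  have hsub : ‖Complex.log (1 - ζ)‖ ≤ 3 / 2 * ‖ζ‖ := by
    have h := Complex.norm_log_one_add_half_le_self (z := -ζ) (by rwa [norm_neg])
    rwa [norm_neg, ← sub_eq_add_neg] at h
  have hadd : ‖Complex.log (1 + (lamC δ t : ℂ) * ζ)‖ ≤ 3 / 2 * ‖ζ‖ :=
    (Complex.norm_log_one_add_half_le_self (hmul.trans hζ)).trans (by gcongr)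
  have hsub0 : 1 - ζ ≠ 0 := by
    rw [sub_eq_add_neg]
    exact one_add_ne_zero_of_norm_le_half (by rwa [norm_neg])
  have hhalf : ‖(-(1 / 2) : ℂ)‖ = 1 / 2 := by simp
  have hpow : ‖((σ : ℂ) - 1 / 2)‖ ≤ k := by
    have hreal : ((σ : ℂ) - 1 / 2) = ((σ - 1 / 2 : ℝ) : ℂ) := by push_cast; rfl
    rwa [hreal, Complex.norm_real, Real.norm_eq_abs]
  obtain ⟨E, hE⟩ : ∃ E, E = Complex.log (1 - ζ) * (-(1 / 2)) +
    Complex.log (1 + (lamC δ t : ℂ) * ζ) * ((σ : ℂ) - 1 / 2) := ⟨_, rfl⟩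
  have hEnorm : ‖E‖ ≤ 2 * (1 + k) * ‖ζ‖ := by
    calc ‖E‖ ≤ 3 / 2 * ‖ζ‖ * (1 / 2) + 3 / 2 * ‖ζ‖ * k := by
          rw [hE]
          refine (norm_add_le _ _).trans ?_
          rw [norm_mul, norm_mul, hhalf]
          gcongr
      _ ≤ 2 * (1 + k) * ‖ζ‖ := by nlinarith [norm_nonneg ζ, mul_nonneg hk0 (norm_nonneg ζ)]
  have hEre : E.re ≤ 1 + k := (Complex.re_le_norm E).trans (by nlinarith [norm_nonneg ζ])
  rw [ampG, Complex.cpow_def_of_ne_zero hsub0,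
    Complex.cpow_def_of_ne_zero (one_add_ne_zero_of_norm_le_half (hmul.trans hζ)),
    ← Complex.exp_add, ← hE, ← Complex.exp_zero]
  refine (norm_exp_sub_exp_le hEre (by rw [Complex.zero_re]; positivity)).trans ?_
  rw [sub_zero]
  nlinarith [mul_le_mul_of_nonneg_left hEnorm (Real.exp_nonneg (1 + (k : ℝ)))]

theorem f1_sub_quadratic_eq (lc Lam : ℝ) (ζ : ℂ) :
    f1 lc Lam ζ - (lc * Real.log (1 + Lam) * ζ + lc * (1 + lc) / 2 * ζ ^ 2) =
      lc * ζ * (Complex.log (1 + lc * ζ) - lc * ζ) - lc * ζ * (Complex.log (1 + -ζ) - -ζ) +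
        (Complex.log (1 + lc * ζ) - (lc * ζ - (lc * ζ) ^ 2 / 2)) +
        lc * (Complex.log (1 + -ζ) - (-ζ - (-ζ) ^ 2 / 2)) := by
  rw [f1, sub_eq_add_neg 1 ζ]
  ring

theorem norm_f1_sub_quadratic_le (hlc : 0 ≤ lc) (hlc1 : lc ≤ 1) (hζ : ‖ζ‖ ≤ 1 / 2) :
    ‖f1 lc Lam ζ - (lc * Real.log (1 + Lam) * ζ + lc * (1 + lc) / 2 * ζ ^ 2)‖ ≤
      4 * lc * ‖ζ‖ ^ 3 := by
  have hnorm : ‖(lc : ℂ) * ζ‖ = lc * ‖ζ‖ := by rw [norm_mul, Complex.norm_of_nonneg hlc]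
  have hle : lc * ‖ζ‖ ≤ ‖ζ‖ := mul_le_of_le_one_left (norm_nonneg ζ) hlc1
  have hmul : ‖(lc : ℂ) * ζ‖ ≤ 1 / 2 := hnorm.trans_le (hle.trans hζ)
  have hneg : ‖-ζ‖ ≤ 1 / 2 := by rwa [norm_neg]
  have hT1 : ‖lc * ζ * (Complex.log (1 + lc * ζ) - lc * ζ)‖ ≤ lc * ‖ζ‖ ^ 3 := by
    calc ‖lc * ζ * (Complex.log (1 + lc * ζ) - lc * ζ)‖ ≤ lc * ‖ζ‖ * (lc * ‖ζ‖) ^ 2 := by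
          rw [norm_mul, hnorm]
          gcongr
          exact (norm_log_one_add_sub_le hmul).trans_eq (by rw [hnorm])
      _ ≤ lc * ‖ζ‖ * ‖ζ‖ ^ 2 := by gcongr
      _ = lc * ‖ζ‖ ^ 3 := by ring
  have hT2 : ‖lc * ζ * (Complex.log (1 + -ζ) - -ζ)‖ ≤ lc * ‖ζ‖ ^ 3 := by
    rw [norm_mul, hnorm, pow_succ' _ 2, ← mul_assoc]
    gcongr
    exact (norm_log_one_add_sub_le hneg).trans_eq (by rw [norm_neg])
  have hT3 : ‖Complex.log (1 + lc * ζ) - (lc * ζ - (lc * ζ) ^ 2 / 2)‖ ≤ lc * ‖ζ‖ ^ 3 := by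
    refine (norm_log_one_add_sub_sub_le hmul).trans ?_
    rw [hnorm, mul_pow]
    gcongr
    exact pow_le_of_le_one hlc hlc1 three_ne_zero
  have hT4 : ‖(lc : ℂ) * (Complex.log (1 + -ζ) - (-ζ - (-ζ) ^ 2 / 2))‖ ≤ lc * ‖ζ‖ ^ 3 := by
    rw [norm_mul, Complex.norm_of_nonneg hlc]
    gcongr
    exact (norm_log_one_add_sub_sub_le hneg).trans_eq (by rw [norm_neg])
  rw [f1_sub_quadratic_eq]
  refine (norm_add_le_of_le (norm_add_le_of_le (norm_sub_le_of_le hT1 hT2) hT3) hT4).trans_eq ?_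
  ring

end LocalExpansion

section QuadraticComparison

variable {δ σ t Lam N w φ r : ℝ} {ζ : ℂ}

/-- The decay exponent, at the rescaled distance `x = √N r` along a ray with `sin φ = s`, shared by
the reduced integrand and its quadratic model. It is affine in `x`, the shift `1 / 4` coming from
`x - 1 / 4 ≤ x²`. -/
noncomputable def decayRate (w s x : ℝ) : ℝ := 2 * w * s * x + s / 4 * (x - 1 / 4)

theorem sqrt_mul_omega (hN : 0 ≤ lamC δ t * t / 2) :
    √(lamC δ t * t / 2) * omega δ t Lam =
      lamC δ t * t / 2 * (Real.log (1 + Lam) / (1 + lamC δ t)) := by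
  rw [omega, ← mul_assoc, Real.mul_self_sqrt hN]

namespace DescentAngle

theorem re_quadraticModel_le {l : ℝ} (h : DescentAngle l φ) (hN : 0 ≤ N) (w r : ℝ) :
    (quadraticModel N w (rayPoint 0 φ r)).re ≤ -decayRate w (Real.sin φ) (√N * r) := by
  have hs := h.sin_pos
  have hsq : N * r ^ 2 = (√N * r) ^ 2 := by rw [mul_pow, Real.sq_sqrt hN]
  have hcos : Real.sin φ * (√N * r) ^ 2 ≤ 2 * Real.cos φ * (Real.sin φ * (√N * r) ^ 2) :=
    le_mul_of_one_le_left (by positivity) (by linarith [h.half_le_cos])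
  have hlinear : Real.sin φ * ((√N * r - 1 / 4) / 4) ≤ Real.sin φ * (√N * r) ^ 2 :=
    mul_le_mul_of_nonneg_left (by nlinarith [sq_nonneg (√N * r - 1 / 8)]) hs.le
  rw [re_quadraticModel_rayPoint, Real.sin_two_mul, decayRate, mul_right_comm N, hsq]
  linarith

theorem exists_le_im_f1 (h : DescentAngle (lamC δ t) φ) (hlc : 0 < lamC δ t)
    (hlc1 : lamC δ t ≤ 1) (Lam : ℝ) {n : ℝ} (hn : 1 ≤ n) (hr : 0 ≤ r) :
    ∃ q, 0 ≤ q ∧ n * r - 1 / 4 ≤ n ^ 2 * q ∧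
      lamC δ t * (Real.sin φ * Real.log (1 + Lam) * r + Real.sin φ * q / 4) ≤
        (f1 (lamC δ t) Lam (rayPoint 0 φ r)).im := by
  rcases le_total r 1 with hr1 | hr1
  · exact ⟨r ^ 2, sq_nonneg r, by nlinarith [sq_nonneg (n * r - 1 / 2)],
      h.le_im_f1_of_le_one hlc.le ⟨hr, hr1⟩⟩
  · refine ⟨r, hr, ?_, h.le_im_f1_of_one_le hlc hlc1 hr1⟩
    have : n * r ≤ n ^ 2 * r := mul_le_mul_of_nonneg_right (by nlinarith) hr
    linarith

theorem re_I_mul_phaseH_le (h : DescentAngle (lamC δ t) φ) (hlc : 0 < lamC δ t)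
    (hlc1 : lamC δ t ≤ 1) (hN : 1 ≤ lamC δ t * t / 2) (Lam : ℝ) (hr : 0 ≤ r) :
    (I * t * phaseH δ t Lam (rayPoint 0 φ r)).re ≤
      -decayRate (omega δ t Lam) (Real.sin φ) (√(lamC δ t * t / 2) * r) := by
  have hs := h.sin_pos
  have ht : 0 < t := pos_of_mul_pos_right (a := lamC δ t) (by linarith) hlc.le
  obtain ⟨n, hn⟩ : ∃ n, n = √(lamC δ t * t / 2) := ⟨_, rfl⟩
  have hnsq : n ^ 2 = lamC δ t * t / 2 := hn ▸ Real.sq_sqrt (by linarith)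
  have homega : n * omega δ t Lam =
      lamC δ t * t / 2 * (Real.log (1 + Lam) / (1 + lamC δ t)) :=
    hn ▸ sqrt_mul_omega (by linarith)
  obtain ⟨q, hq, hle, him⟩ := h.exists_le_im_f1 hlc hlc1 Lam (hn ▸ Real.one_le_sqrt.2 hN) hr
  have hscale : t / (1 + lamC δ t) *
      (lamC δ t * (Real.sin φ * Real.log (1 + Lam) * r + Real.sin φ * q / 4)) =
        2 * (n * omega δ t Lam) * Real.sin φ * r +
          2 / (1 + lamC δ t) * (Real.sin φ / 4 * (n ^ 2 * q)) := by
    rw [homega, hnsq]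
    field_simp
  have htwo : 1 ≤ 2 / (1 + lamC δ t) := by
    rw [le_div_iff₀ (by positivity)]
    linarith
  have hquad : Real.sin φ / 4 * (n * r - 1 / 4) ≤
      2 / (1 + lamC δ t) * (Real.sin φ / 4 * (n ^ 2 * q)) :=
    (mul_le_mul_of_nonneg_left hle (by positivity)).trans
      (le_mul_of_one_le_left (by positivity) htwo)
  have hphase := mul_le_mul_of_nonneg_left him (show 0 ≤ t / (1 + lamC δ t) by positivity)
  rw [re_I_mul_phaseH, decayRate, ← hn]
  linarith

end DescentAngle

theorem norm_phaseH_sub_quadraticModel_le (hlc : 0 ≤ lamC δ t) (hlc1 : lamC δ t ≤ 1) (ht : 0 ≤ t)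
    (hζ : ‖ζ‖ ≤ 1 / 2) :
    ‖I * t * phaseH δ t Lam ζ - quadraticModel (lamC δ t * t / 2) (omega δ t Lam) ζ‖ ≤
      8 * (lamC δ t * t / 2) * ‖ζ‖ ^ 3 := by
  have hlc0 : 1 + (lamC δ t : ℂ) ≠ 0 := by
    have : 1 + lamC δ t ≠ 0 := by positivity
    exact_mod_cast this
  have homega : (√(lamC δ t * t / 2) : ℂ) * omega δ t Lam =
      lamC δ t * t / 2 * (Real.log (1 + Lam) / (1 + lamC δ t)) := by
    exact_mod_cast sqrt_mul_omega (Lam := Lam) (by positivity : 0 ≤ lamC δ t * t / 2)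
  have hdiff : I * t * phaseH δ t Lam ζ - quadraticModel (lamC δ t * t / 2) (omega δ t Lam) ζ =
      I * (((t / (1 + lamC δ t) : ℝ) : ℂ) * (f1 (lamC δ t) Lam ζ -
        (lamC δ t * Real.log (1 + Lam) * ζ +
          lamC δ t * (1 + lamC δ t) / 2 * ζ ^ 2))) := by
    rw [phaseH, quadraticModel, mul_assoc (2 : ℂ), homega]
    push_cast
    field_simp
    ring
  rw [hdiff, norm_mul, Complex.norm_I, one_mul, norm_mul, Complex.norm_of_nonneg (by positivity)]
  calc t / (1 + lamC δ t) * _ ≤ t * (4 * lamC δ t * ‖ζ‖ ^ 3) :=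
        mul_le_mul (div_le_self ht (by linarith)) (norm_f1_sub_quadratic_le hlc hlc1 hζ)
          (norm_nonneg _) ht
    _ = 8 * (lamC δ t * t / 2) * ‖ζ‖ ^ 3 := by ring

namespace DescentAngle

theorem norm_integrandTilde_sub_exp_le_of_le_half {k : ℕ} (hk : |σ - 1 / 2| ≤ k)
    (h : DescentAngle (lamC δ t) φ) (hlc : 0 < lamC δ t) (hlc1 : lamC δ t ≤ 1)
    (hN : 1 ≤ lamC δ t * t / 2) (Lam : ℝ) (hr : r ∈ Icc 0 (1 / 2)) :
    ‖integrandTilde δ σ t Lam (rayPoint 0 φ r) -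
        Complex.exp (quadraticModel (lamC δ t * t / 2) (omega δ t Lam) (rayPoint 0 φ r))‖ ≤
      (2 * (1 + k) * Real.exp (1 + k) * r + 8 * (lamC δ t * t / 2) * r ^ 3) *
        Real.exp (-decayRate (omega δ t Lam) (Real.sin φ) (√(lamC δ t * t / 2) * r)) := by
  have ht : 0 < t := pos_of_mul_pos_right (a := lamC δ t) (by linarith) hlc.le
  have hnorm : ‖rayPoint 0 φ r‖ = r := norm_rayPoint_zero φ hr.1
  have hhalf : ‖rayPoint 0 φ r‖ ≤ 1 / 2 := hnorm.trans_le hr.2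
  have hphase := h.re_I_mul_phaseH_le hlc hlc1 hN Lam hr.1
  have hmodel := h.re_quadraticModel_le (N := lamC δ t * t / 2) (by linarith) (omega δ t Lam) r
  have hamp := norm_ampG_sub_one_le (ζ := rayPoint 0 φ r) hk hlc.le hlc1 hhalf
  have hdiff := norm_phaseH_sub_quadraticModel_le (Lam := Lam) hlc.le hlc1 ht.le hhalf
  rw [hnorm] at hamp hdiff
  have hsplit : ∀ a x y : ℂ, a * x - y = (a - 1) * x + (x - y) := fun a x y => by ring
  rw [integrandTilde, hsplit, add_mul]
  refine norm_add_le_of_le ?_ ?_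
  · rw [norm_mul, Complex.norm_exp]
    exact mul_le_mul hamp (Real.exp_le_exp.2 hphase) (Real.exp_nonneg _)
      ((norm_nonneg _).trans hamp)
  · refine (norm_exp_sub_exp_le hphase hmodel).trans ?_
    rw [mul_comm]
    gcongr

theorem norm_integrandTilde_sub_exp_le_of_half_le {k : ℕ} (hk : |σ - 1 / 2| ≤ k)
    (h : DescentAngle (lamC δ t) φ) (hlc : 0 < lamC δ t) (hlc1 : lamC δ t ≤ 1)
    (hN : 1 ≤ lamC δ t * t / 2) (Lam : ℝ) (hr : 1 / 2 ≤ r) :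
    ‖integrandTilde δ σ t Lam (rayPoint 0 φ r) -
        Complex.exp (quadraticModel (lamC δ t * t / 2) (omega δ t Lam) (rayPoint 0 φ r))‖ ≤
      4 / Real.sin φ * r * (1 + r) ^ k *
        Real.exp (-decayRate (omega δ t Lam) (Real.sin φ) (√(lamC δ t * t / 2) * r)) := by
  have hr0 : 0 ≤ r := by linarith
  have hs := h.sin_pos
  have hphase := h.re_I_mul_phaseH_le hlc hlc1 hN Lam hr0
  have hmodel := h.re_quadraticModel_le (N := lamC δ t * t / 2) (by linarith) (omega δ t Lam) r
  have hamp : ‖ampG δ σ t (rayPoint 0 φ r)‖ ≤ 1 / Real.sin φ * (1 + r) ^ k :=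
    (norm_ampG_le hk hlc.le hs h.cos_pos.le hr0).trans
      (by gcongr; exact mul_le_of_le_one_left hr0 hlc1)
  have hone : 1 ≤ 1 / Real.sin φ * (1 + r) ^ k :=
    one_le_mul_of_one_le_of_one_le ((one_le_div hs).2 (Real.sin_le_one φ))
      (one_le_pow₀ (by linarith))
  have hfour : 2 * (1 / Real.sin φ * (1 + r) ^ k) ≤ 4 / Real.sin φ * r * (1 + r) ^ k := by
    have : 4 / Real.sin φ * r * (1 + r) ^ k = 4 * r * (1 / Real.sin φ * (1 + r) ^ k) := by ring
    rw [this]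
    gcongr
    linarith
  have htilde : ‖integrandTilde δ σ t Lam (rayPoint 0 φ r)‖ ≤ 1 / Real.sin φ * (1 + r) ^ k *
      Real.exp (-decayRate (omega δ t Lam) (Real.sin φ) (√(lamC δ t * t / 2) * r)) := by
    rw [integrandTilde, norm_mul, Complex.norm_exp]
    gcongr
  refine (norm_sub_le_of_le htilde
    ((Complex.norm_exp _).trans_le (Real.exp_le_exp.2 hmodel))).trans ?_
  rw [← add_one_mul]
  gcongr
  linarith

theorem norm_integrandTilde_sub_exp_le {k : ℕ} (hk : |σ - 1 / 2| ≤ k)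
    (h : DescentAngle (lamC δ t) φ) (hlc : 0 < lamC δ t) (hlc1 : lamC δ t ≤ 1)
    (hN : 1 ≤ lamC δ t * t / 2) (Lam : ℝ) (hr : 0 ≤ r) :
    ‖integrandTilde δ σ t Lam (rayPoint 0 φ r) -
        Complex.exp (quadraticModel (lamC δ t * t / 2) (omega δ t Lam) (rayPoint 0 φ r))‖ ≤
      (2 * (1 + k) * Real.exp (1 + k) + 8) / Real.sin φ * (r + lamC δ t * t / 2 * r ^ 3) *
        (1 + r) ^ k *
        Real.exp (-decayRate (omega δ t Lam) (Real.sin φ) (√(lamC δ t * t / 2) * r)) := by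
  have hs := h.sin_pos
  have hN0 : 0 ≤ lamC δ t * t / 2 := by linarith
  obtain ⟨A, hA⟩ : ∃ A : ℝ, A = 2 * (1 + k) * Real.exp (1 + k) := ⟨_, rfl⟩
  have hA0 : 0 ≤ A := hA ▸ by positivity
  rw [← hA]
  rcases le_total r (1 / 2) with hr2 | hr2
  · refine (h.norm_integrandTilde_sub_exp_le_of_le_half hk hlc hlc1 hN Lam ⟨hr, hr2⟩).trans ?_
    rw [← hA]
    gcongr
    calc A * r + 8 * (lamC δ t * t / 2) * r ^ 3
        ≤ (A + 8) * (r + lamC δ t * t / 2 * r ^ 3) := by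
          nlinarith [mul_nonneg hA0 (mul_nonneg hN0 (pow_nonneg hr 3))]
      _ ≤ (A + 8) / Real.sin φ * (r + lamC δ t * t / 2 * r ^ 3) := by
          gcongr
          exact le_div_self (by positivity) hs (Real.sin_le_one φ)
      _ ≤ (A + 8) / Real.sin φ * (r + lamC δ t * t / 2 * r ^ 3) * (1 + r) ^ k :=
          le_mul_of_one_le_right (by positivity) (one_le_pow₀ (by linarith))
  · refine (h.norm_integrandTilde_sub_exp_le_of_half_le hk hlc hlc1 hN Lam hr2).trans ?_
    gcongr
    · linarith
    · exact le_add_of_nonneg_right (by positivity)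

end DescentAngle

end QuadraticComparison

section LeadingTerm

variable {δ σ t Lam φ w s x n : ℝ}

theorem one_add_mul_exp_neg_mul_le {y : ℝ} (hw : 0 ≤ w) (hy : 0 < y) :
    (1 + w) * Real.exp (-(y * w)) ≤ 1 + 1 / y := by
  rw [Real.exp_neg, ← div_eq_mul_inv, div_le_iff₀ (Real.exp_pos _)]
  calc 1 + w ≤ (1 + 1 / y) * (y * w + 1) := by
        have : (1 + 1 / y) * (y * w + 1) = 1 + w + (y * w + 1 / y) := by field_simp; ring
        rw [this]
        exact le_add_of_nonneg_right (by positivity)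
    _ ≤ (1 + 1 / y) * Real.exp (y * w) := by
        gcongr
        exact Real.add_one_le_exp _

theorem one_add_mul_exp_neg_decayRate_le (hw : 0 ≤ w) (hs : 0 < s) (hs1 : s ≤ 1) (hx : 0 < x) :
    (1 + w) * Real.exp (-decayRate w s x) ≤
      (1 + 1 / (2 * s * x)) * (2 * Real.exp (-(s / 4 * x))) := by
  have hsplit : Real.exp (-decayRate w s x) =
      Real.exp (-(2 * s * x * w)) * (Real.exp (s / 16) * Real.exp (-(s / 4 * x))) := by
    rw [← Real.exp_add, ← Real.exp_add, decayRate]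
    ring_nf
  have htwo : Real.exp (s / 16) ≤ 2 := by
    rw [← Real.le_log_iff_exp_le two_pos]
    linarith [Real.log_two_gt_d9]
  rw [hsplit, ← mul_assoc]
  gcongr
  exact one_add_mul_exp_neg_mul_le hw (by positivity)

theorem one_add_mul_cubic_mul_exp_neg_decayRate_le (hw : 0 ≤ w) (hs : 0 < s) (hs1 : s ≤ 1)
    (hx : 0 < x) :
    (1 + w) * ((x + x ^ 3) * Real.exp (-decayRate w s x)) ≤
      2 / s * ((1 + x) ^ 3 * Real.exp (-(s / 4 * x))) := by
  have hcubic : (x + x ^ 3) * (1 + 1 / (2 * s * x)) ≤ 1 / s * (1 + x) ^ 3 := by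
    have hexpand : (x + x ^ 3) * (1 + 1 / (2 * s * x)) =
        1 / s * (s * (x + x ^ 3) + (1 + x ^ 2) / 2) := by
      field_simp
    rw [hexpand]
    gcongr
    have : s * (x + x ^ 3) ≤ x + x ^ 3 := mul_le_of_le_one_left (by positivity) hs1
    nlinarith [sq_nonneg x]
  calc (1 + w) * ((x + x ^ 3) * Real.exp (-decayRate w s x))
      = (x + x ^ 3) * ((1 + w) * Real.exp (-decayRate w s x)) := by ring
    _ ≤ (x + x ^ 3) * ((1 + 1 / (2 * s * x)) * (2 * Real.exp (-(s / 4 * x)))) :=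
        mul_le_mul_of_nonneg_left (one_add_mul_exp_neg_decayRate_le hw hs hs1 hx) (by positivity)
    _ = (x + x ^ 3) * (1 + 1 / (2 * s * x)) * (2 * Real.exp (-(s / 4 * x))) := by ring
    _ ≤ 1 / s * (1 + x) ^ 3 * (2 * Real.exp (-(s / 4 * x))) := by gcongr
    _ = 2 / s * ((1 + x) ^ 3 * Real.exp (-(s / 4 * x))) := by ring

theorem rescaled_majorant_le {A r : ℝ} (k : ℕ) (hA : 0 ≤ A) (hw : 0 ≤ w) (hs : 0 < s)
    (hs1 : s ≤ 1) (hn : 1 ≤ n) (hr : 0 < r) :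
    A / s * (r + n ^ 2 * r ^ 3) * (1 + r) ^ k * Real.exp (-decayRate w s (n * r)) ≤
      2 * A / (s ^ 2 * n * (1 + w)) *
        ((1 + n * r) ^ (k + 3) * Real.exp (-(s / 4 * (n * r)))) := by
  have hn0 : 0 < n := zero_lt_one.trans_le hn
  have hdecay := one_add_mul_cubic_mul_exp_neg_decayRate_le hw hs hs1 (mul_pos hn0 hr)
  rw [← le_div_iff₀' (by positivity)] at hdecay
  calc A / s * (r + n ^ 2 * r ^ 3) * (1 + r) ^ k * Real.exp (-decayRate w s (n * r))
      = A / (s * n) * (1 + r) ^ k *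
          ((n * r + (n * r) ^ 3) * Real.exp (-decayRate w s (n * r))) := by
        field_simp
    _ ≤ A / (s * n) * (1 + n * r) ^ k *
          (2 / s * ((1 + n * r) ^ 3 * Real.exp (-(s / 4 * (n * r)))) / (1 + w)) := by
        gcongr
        exact le_mul_of_one_le_left hr.le hn
    _ = 2 * A / (s ^ 2 * n * (1 + w)) *
          ((1 + n * r) ^ (k + 3) * Real.exp (-(s / 4 * (n * r)))) := by
        rw [pow_add]
        field_simp

theorem norm_rayIntegral_sub_le {f g : ℂ → ℂ} {a : ℂ} {B : ℝ → ℝ} (hf : RayIntegrable f a φ)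
    (hg : RayIntegrable g a φ) (hB : IntegrableOn B (Ioi 0))
    (hfg : ∀ r ∈ Ioi (0 : ℝ), ‖f (rayPoint a φ r) - g (rayPoint a φ r)‖ ≤ B r) :
    ‖rayIntegral f a φ - rayIntegral g a φ‖ ≤ ∫ r in Ioi (0 : ℝ), B r := by
  rw [rayIntegral, rayIntegral, ← integral_sub hf hg]
  refine norm_integral_le_of_norm_le hB ?_
  filter_upwards [ae_restrict_mem measurableSet_Ioi] with r hr
  rw [← sub_mul, norm_mul, norm_exp_I_mul, mul_one]
  exact hfg r hr

theorem leadingTerm_eq (δ t Lam : ℝ) :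
    leadingTerm δ t Lam = ((1 / √(lamC δ t * t / 2) : ℝ) : ℂ) *
      (Complex.exp (-I * (omega δ t Lam : ℂ) ^ 2) * fresnel (omega δ t Lam)) := by
  have hsqrt : √(2 / (lamC δ t * t)) = 1 / √(lamC δ t * t / 2) := by
    rw [← Real.sqrt_one, ← Real.sqrt_div zero_le_one, one_div_div]
  rw [leadingTerm, hsqrt]
  ring

theorem norm_leadingTerm (δ t Lam : ℝ) :
    ‖leadingTerm δ t Lam‖ = ‖fresnel (omega δ t Lam)‖ / √(lamC δ t * t / 2) := by
  rw [leadingTerm_eq, norm_mul, norm_mul, norm_exp_neg_I_mul_sq, one_mul,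
    Complex.norm_of_nonneg (by positivity)]
  ring

theorem DescentAngle.norm_JBtilde_sub_leadingTerm_le {k : ℕ} (hk : |σ - 1 / 2| ≤ k)
    (h : DescentAngle (lamC δ t) φ) (hδ : δ < 1) (ht : 1 < t) (hLam : 0 ≤ Lam)
    (hlc1 : lamC δ t ≤ 1) (hN : 1 ≤ lamC δ t * t / 2) :
    ‖JBtilde δ σ t Lam φ - leadingTerm δ t Lam‖ ≤
      2 * (2 * (1 + k) * Real.exp (1 + k) + 8) /
          (Real.sin φ ^ 2 * √(lamC δ t * t / 2) * (1 + omega δ t Lam)) *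
        ((√(lamC δ t * t / 2))⁻¹ *
          ((k + 3).factorial / (Real.sin φ / 8) ^ (k + 4) * Real.exp (Real.sin φ / 8))) := by
  have hlc := lamC_pos hδ ht
  have hw := omega_nonneg hδ ht hLam
  have hs := h.sin_pos
  have hN0 : 0 < lamC δ t * t / 2 := by linarith
  have hn : 1 ≤ √(lamC δ t * t / 2) := Real.one_le_sqrt.2 hN
  have hn0 := zero_lt_one.trans_le hn
  have hadm : AdmissibleAngle (lamC δ t * (1 + Lam)) φ :=
    h.admissibleAngle hlc (le_mul_of_one_le_right hlc.le (by linarith))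
  have hb : 0 < Real.sin φ / 4 := by positivity
  have hint : IntegrableOn (fun r => (1 + √(lamC δ t * t / 2) * r) ^ (k + 3) *
      Real.exp (-(Real.sin φ / 4 * (√(lamC δ t * t / 2) * r)))) (Ioi 0) := by
    have hiff := integrableOn_Ioi_comp_mul_left_iff
      (fun x => (1 + x) ^ (k + 3) * Real.exp (-(Real.sin φ / 4 * x))) 0 hn0
    rw [mul_zero] at hiff
    exact hiff.2 (integrableOn_one_add_pow_mul_exp_neg_mul_Ioi (k + 3) hb)
  rw [leadingTerm_eq, ← rayIntegral_exp_quadraticModel hN0 hw h.pos h.le_pi_div_four]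
  refine (norm_rayIntegral_sub_le (rayIntegrable_integrandTilde σ hδ ht (by linarith) hadm)
    (rayIntegrable_exp_quadraticModel hN0 hw h.pos h.le_pi_div_four) (hint.const_mul
      (2 * (2 * (1 + k) * Real.exp (1 + k) + 8) /
        (Real.sin φ ^ 2 * √(lamC δ t * t / 2) * (1 + omega δ t Lam))))
    fun r hr => (h.norm_integrandTilde_sub_exp_le hk hlc hlc1 hN Lam (le_of_lt hr)).trans ?_).trans
      ?_
  · have hmajorant := rescaled_majorant_le k
      (by positivity : 0 ≤ 2 * (1 + k) * Real.exp (1 + k) + 8) hw hs (Real.sin_le_one φ) hn hr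
    rwa [Real.sq_sqrt hN0.le] at hmajorant
  · have hbound := integral_one_add_pow_mul_exp_neg_mul_Ioi_le (k + 3) hb
    rw [div_div, show (4 : ℝ) * 2 = 8 by norm_num] at hbound
    rw [integral_const_mul, integral_comp_mul_left_Ioi
      (fun x => (1 + x) ^ (k + 3) * Real.exp (-(Real.sin φ / 4 * x))) 0 hn0, mul_zero, smul_eq_mul]
    gcongr

theorem exists_norm_JBtilde_sub_leadingTerm_le (σ : ℝ) :
    ∃ C : ℝ, 0 < C ∧ ∃ m : ℕ, ∀ {δ t Lam φ : ℝ}, δ < 1 → 1 < t → 0 ≤ Lam → lamC δ t ≤ 1 →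
      1 ≤ lamC δ t * t / 2 → DescentAngle (lamC δ t) φ →
        ‖JBtilde δ σ t Lam φ - leadingTerm δ t Lam‖ ≤
          C / (Real.sin φ ^ m * (lamC δ t * t / 2) * (1 + omega δ t Lam)) := by
  obtain ⟨k, hk⟩ := exists_nat_ge |σ - 1 / 2|
  refine ⟨2 * (2 * (1 + k) * Real.exp (1 + k) + 8) *
    ((k + 3).factorial * 8 ^ (k + 4) * Real.exp 1), by positivity, k + 6, ?_⟩
  intro δ t Lam φ hδ ht hLam hlc1 hN h
  have hw := omega_nonneg hδ ht hLam
  have hs := h.sin_pos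
  have : 0 < √(lamC δ t * t / 2) := Real.sqrt_pos.2 (by linarith)
  have hexp : Real.exp (Real.sin φ / 8) ≤ Real.exp 1 :=
    Real.exp_le_exp.2 (by linarith [Real.sin_le_one φ])
  refine (h.norm_JBtilde_sub_leadingTerm_le hk hδ ht hLam hlc1 hN).trans ?_
  calc _ ≤ 2 * (2 * (1 + k) * Real.exp (1 + k) + 8) /
          (Real.sin φ ^ 2 * √(lamC δ t * t / 2) * (1 + omega δ t Lam)) *
        ((√(lamC δ t * t / 2))⁻¹ *
          ((k + 3).factorial / (Real.sin φ / 8) ^ (k + 4) * Real.exp 1)) := by gcongr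
    _ = 2 * (2 * (1 + k) * Real.exp (1 + k) + 8) *
          ((k + 3).factorial * 8 ^ (k + 4) * Real.exp 1) /
          (Real.sin φ ^ (k + 6) * √(lamC δ t * t / 2) ^ 2 * (1 + omega δ t Lam)) := by
        rw [div_pow, pow_add _ k 6, pow_add _ k 4]
        field_simp
    _ = _ := by rw [Real.sq_sqrt (by linarith)]

end LeadingTerm

section LargeTime

variable {δ σ t Lam φ η : ℝ}

theorem rpow_sub_one_le_lamC (hδ : δ < 1) (ht : 1 < t) : t ^ (δ - 1) ≤ lamC δ t := by
  obtain ⟨h0, h1⟩ := rpow_sub_one_mem_Ioo hδ ht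
  exact le_div_self h0.le (by linarith) (by linarith)

theorem tendsto_lamC_atTop (hδ : δ < 1) : Tendsto (lamC δ) atTop (𝓝 0) := by
  have hpow : Tendsto (fun t : ℝ => t ^ (δ - 1)) atTop (𝓝 0) := by
    simpa only [neg_sub] using tendsto_rpow_neg_atTop (sub_pos.2 hδ)
  have hdiv := hpow.div (tendsto_const_nhds.sub hpow) (by norm_num : (1 : ℝ) - 0 ≠ 0)
  rwa [zero_div] at hdiv

theorem rpow_le_lamC_mul (hδ : δ < 1) (ht : 1 < t) : t ^ δ ≤ lamC δ t * t := by
  have ht0 : 0 < t := by linarith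
  calc t ^ δ = t ^ (δ - 1) * t := by rw [Real.rpow_sub_one ht0.ne', div_mul_cancel₀ _ ht0.ne']
    _ ≤ lamC δ t * t := by
      gcongr
      exact rpow_sub_one_le_lamC hδ ht

theorem rpow_half_div_two_le_sqrt (hδ : δ < 1) (ht : 1 < t) :
    t ^ (δ / 2) / 2 ≤ √(lamC δ t * t / 2) := by
  have ht0 : 0 < t := by linarith
  refine Real.le_sqrt_of_sq_le ?_
  rw [div_pow, ← Real.rpow_mul_natCast ht0.le, Nat.cast_two, div_mul_cancel₀ _ two_ne_zero]
  linarith [rpow_le_lamC_mul hδ ht, Real.rpow_pos_of_pos ht0 δ]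

theorem neg_log_lamC_le (hδ0 : 0 ≤ δ) (hδ : δ < 1) (ht : 1 < t) :
    -Real.log (lamC δ t) ≤ Real.log t := by
  have hlog := Real.log_le_log (rpow_sub_one_mem_Ioo hδ ht).1 (rpow_sub_one_le_lamC hδ ht)
  rw [Real.log_rpow (by linarith)] at hlog
  linarith [mul_nonneg hδ0 (Real.log_nonneg ht.le)]

theorem exists_descentAngle_lamC (hδ0 : 0 ≤ δ) (hδ : δ < 1) (ht : 1 < t)
    (hlc : lamC δ t ≤ Real.exp (-1)) :
    ∃ φ, DescentAngle (lamC δ t) φ ∧ 1 / Real.sin φ ≤ 8 * Real.log t := by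
  have hlog := Real.log_le_log (lamC_pos hδ ht) hlc
  rw [Real.log_exp] at hlog
  obtain ⟨φ, hφ, hsin⟩ := exists_descentAngle (lamC_pos hδ ht) hlc
  refine ⟨φ, hφ, ?_⟩
  rw [one_div_le (by linarith) hφ.sin_pos] at hsin
  exact hsin.trans (by gcongr; exact neg_log_lamC_le hδ0 hδ ht)

theorem eventually_log_pow_le_mul_sqrt (hδ0 : 0 < δ) (hδ : δ < 1) (m : ℕ) {ε : ℝ} (hε : 0 < ε) :
    ∀ᶠ t in atTop, Real.log t ^ m ≤ ε * √(lamC δ t * t / 2) := by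
  filter_upwards [(isLittleO_log_rpow_rpow_atTop m (half_pos hδ0)).bound (half_pos hε),
    eventually_gt_atTop 1] with t hlog ht
  rw [Real.norm_of_nonneg (by have := Real.log_pos ht; positivity),
    Real.norm_of_nonneg (by positivity), Real.rpow_natCast] at hlog
  calc Real.log t ^ m ≤ ε * (t ^ (δ / 2) / 2) := hlog.trans_eq (by ring)
    _ ≤ ε * √(lamC δ t * t / 2) := by
      gcongr
      exact rpow_half_div_two_le_sqrt hδ ht

theorem exists_le_norm_leadingTerm :
    ∃ c : ℝ, 0 < c ∧ ∀ {δ t Lam : ℝ}, 0 ≤ omega δ t Lam →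
      c / (√(lamC δ t * t / 2) * (1 + omega δ t Lam)) ≤ ‖leadingTerm δ t Lam‖ := by
  obtain ⟨c, hc, hle⟩ := exists_le_norm_fresnel
  refine ⟨c, hc, fun {δ t Lam} hw => ?_⟩
  rw [norm_leadingTerm, mul_comm, ← div_div]
  gcongr
  exact hle _ hw

theorem exists_eq_mul_one_add {x y : ℂ} (hy : y ≠ 0) (h : ‖x - y‖ ≤ η * ‖y‖) :
    ∃ e : ℂ, ‖e‖ ≤ η ∧ x = y * (1 + e) := by
  refine ⟨(x - y) / y, ?_, ?_⟩
  · rwa [norm_div, div_le_iff₀ (norm_pos_iff.2 hy)]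
  · field_simp
    ring

theorem eventually_norm_JBtilde_sub_leadingTerm_le (σ : ℝ) (hδ0 : 0 < δ) (hδ : δ < 1)
    (hη : 0 < η) :
    ∀ᶠ t in atTop, ∀ Lam, 0 ≤ Lam → ∀ φ, AdmissibleAngle (lamC δ t * (1 + Lam)) φ →
      ‖JBtilde δ σ t Lam φ - leadingTerm δ t Lam‖ ≤
        η / (√(lamC δ t * t / 2) * (1 + omega δ t Lam)) := by
  obtain ⟨C, hC, m, hbound⟩ := exists_norm_JBtilde_sub_leadingTerm_le σ
  filter_upwards [eventually_log_pow_le_mul_sqrt hδ0 hδ m (by positivity : 0 < η / (C * 8 ^ m)),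
    eventually_gt_atTop 1, (tendsto_lamC_atTop hδ).eventually_le_const (Real.exp_pos (-1)),
    (tendsto_rpow_atTop hδ0).eventually_ge_atTop 2] with t hlog ht hlc hpow Lam hLam φ hφ
  have hN : 1 ≤ lamC δ t * t / 2 := by linarith [rpow_le_lamC_mul hδ ht]
  have hlc0 := lamC_pos hδ ht
  have hw := omega_nonneg hδ ht hLam
  obtain ⟨θ, hθ, hsin⟩ := exists_descentAngle_lamC hδ0.le hδ ht hlc
  have hs := hθ.sin_pos
  have hsin_pow : C / Real.sin θ ^ m ≤ η * √(lamC δ t * t / 2) := by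
    calc C / Real.sin θ ^ m = C * (1 / Real.sin θ) ^ m := by rw [one_div_pow]; ring
      _ ≤ C * (8 * Real.log t) ^ m := by gcongr
      _ ≤ C * 8 ^ m * (η / (C * 8 ^ m) * √(lamC δ t * t / 2)) := by
        rw [mul_pow, ← mul_assoc]
        gcongr
      _ = η * √(lamC δ t * t / 2) := by field_simp
  rw [JBtilde_eq_of_admissibleAngle σ hδ ht (by linarith) hφ
    (hθ.admissibleAngle hlc0 (le_mul_of_one_le_right hlc0.le (by linarith)))]
  calc ‖JBtilde δ σ t Lam θ - leadingTerm δ t Lam‖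
      ≤ C / (Real.sin θ ^ m * (lamC δ t * t / 2) * (1 + omega δ t Lam)) :=
        hbound hδ ht hLam (hlc.trans (Real.exp_le_one_iff.2 (by norm_num))) hN hθ
    _ = C / Real.sin θ ^ m / (√(lamC δ t * t / 2) ^ 2 * (1 + omega δ t Lam)) := by
        rw [Real.sq_sqrt (by linarith), div_div, mul_assoc]
    _ ≤ η * √(lamC δ t * t / 2) / (√(lamC δ t * t / 2) ^ 2 * (1 + omega δ t Lam)) := by gcongr
    _ = η / (√(lamC δ t * t / 2) * (1 + omega δ t Lam)) := by
        have : √(lamC δ t * t / 2) ≠ 0 := (Real.sqrt_pos.2 (by linarith)).ne'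
        field_simp

theorem exists_forall_JBtilde_eq_leadingTerm_mul (σ : ℝ) (hδ0 : 0 < δ) (hδ : δ < 1)
    (hη : 0 < η) :
    ∃ T : ℝ, 1 < T ∧ ∀ t, T ≤ t → ∀ Lam, 0 ≤ Lam →
      ∀ φ, AdmissibleAngle (lamC δ t * (1 + Lam)) φ →
        ∃ e : ℂ, ‖e‖ ≤ η ∧ JBtilde δ σ t Lam φ = leadingTerm δ t Lam * (1 + e) := by
  obtain ⟨c, hc, hlead⟩ := exists_le_norm_leadingTerm
  obtain ⟨T, hT⟩ := eventually_atTop.1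
    ((eventually_norm_JBtilde_sub_leadingTerm_le σ hδ0 hδ (mul_pos hη hc)).and
      (eventually_gt_atTop 1))
  refine ⟨max T 2, lt_max_of_lt_right one_lt_two, fun t hle Lam hLam φ hφ => ?_⟩
  obtain ⟨hbound, ht⟩ := hT t ((le_max_left _ _).trans hle)
  have hlc := lamC_pos hδ ht
  have hw := omega_nonneg hδ ht hLam
  have hlow := hlead hw
  have hne : leadingTerm δ t Lam ≠ 0 := norm_pos_iff.1 (lt_of_lt_of_le (by positivity) hlow)
  refine exists_eq_mul_one_add hne ((hbound Lam hLam φ hφ).trans ?_)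
  rw [mul_div_assoc]
  gcongr

end LargeTime

end UniformJB

theorem theorem1_general {δ : ℝ} (σ : ℝ) (hδ0 : 0 < δ) (hδ1 : δ < 1) {R : ℝ → Set ℝ}
    (hR : ∀ t, R t ⊆ Set.Ici (lamC δ t)) :
    (∀ t : ℝ, 1 < t → ∀ Lam : ℝ, lamC δ t * (1 + Lam) ∈ R t →
      ∀ φ : ℝ, AdmissibleAngle (lamC δ t * (1 + Lam)) φ →
        RayIntegrable (integrandJB σ t (lamC δ t * (1 + Lam)))
          ((1 - t ^ (δ - 1) : ℝ) : ℂ) φ ∧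
        RayIntegrable (integrandTilde δ σ t Lam) 0 φ) ∧
    (∀ w : ℝ, 0 ≤ w → RayIntegrable fresnelIntegrand (w : ℂ) (Real.pi / 4)) ∧
    (∀ t : ℝ, 1 < t → ∀ Lam : ℝ, lamC δ t * (1 + Lam) ∈ R t →
      ∀ φ : ℝ, AdmissibleAngle (lamC δ t * (1 + Lam)) φ →
        JB δ σ t (lamC δ t * (1 + Lam)) φ = prefactor δ σ t Lam * JBtilde δ σ t Lam φ) ∧
    (∀ t : ℝ, 1 < t → ∀ Lam : ℝ, lamC δ t * (1 + Lam) ∈ R t → 0 ≤ omega δ t Lam) ∧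
    (∀ η : ℝ, 0 < η → ∃ T : ℝ, 1 < T ∧ ∀ t : ℝ, T ≤ t →
      ∀ Lam : ℝ, lamC δ t * (1 + Lam) ∈ R t →
      ∀ φ : ℝ, AdmissibleAngle (lamC δ t * (1 + Lam)) φ →
        ∃ e : ℂ, ‖e‖ ≤ η ∧
          JBtilde δ σ t Lam φ = leadingTerm δ t Lam * (1 + e) ∧
          JB δ σ t (lamC δ t * (1 + Lam)) φ =
            prefactor δ σ t Lam * (leadingTerm δ t Lam * (1 + e))) ∧
    (∃ C : ℝ, ∀ t : ℝ, 1 < t → ∀ Lam : ℝ, lamC δ t * (1 + Lam) ∈ R t →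
      ‖fresnel (omega δ t Lam)‖ ≤ C) ∧
    (∃ C W : ℝ, 0 < W ∧
      (∀ t : ℝ, 1 < t → ∀ Lam : ℝ, lamC δ t * (1 + Lam) ∈ R t →
        W ≤ omega δ t Lam →
          ‖Complex.exp (-Complex.I * (omega δ t Lam : ℂ) ^ 2) * fresnel (omega δ t Lam)
              - (-1 / (2 * Complex.I * (omega δ t Lam : ℂ)))‖ ≤ C / omega δ t Lam ^ 3) ∧
      (∀ η : ℝ, 0 < η → ∃ T : ℝ, 1 < T ∧ ∀ t : ℝ, T ≤ t →
        ∀ Lam : ℝ, lamC δ t * (1 + Lam) ∈ R t → W ≤ omega δ t Lam →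
        ∀ φ : ℝ, AdmissibleAngle (lamC δ t * (1 + Lam)) φ →
          ∃ r e : ℂ, ‖r‖ ≤ C / omega δ t Lam ^ 3 ∧ ‖e‖ ≤ η ∧
            JBtilde δ σ t Lam φ =
              (Real.sqrt (2 / (lamC δ t * t)) : ℂ) *
                (-1 / (2 * Complex.I * (omega δ t Lam : ℂ)) + r) * (1 + e))) := by
  have hLam : ∀ {t Lam : ℝ}, 1 < t → lamC δ t * (1 + Lam) ∈ R t → 0 ≤ Lam := fun ht h =>
    nonneg_of_lamC_le_mul hδ1 ht (hR _ h)
  have hLam_neg_one : ∀ {t Lam : ℝ}, 1 < t → lamC δ t * (1 + Lam) ∈ R t → -1 < Lam := fun ht h =>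
    neg_one_lt_zero.trans_le (hLam ht h)
  have hJB : ∀ t : ℝ, 1 < t → ∀ Lam : ℝ, lamC δ t * (1 + Lam) ∈ R t →
      ∀ φ : ℝ, AdmissibleAngle (lamC δ t * (1 + Lam)) φ →
        JB δ σ t (lamC δ t * (1 + Lam)) φ = prefactor δ σ t Lam * JBtilde δ σ t Lam φ :=
    fun t ht Lam h φ hφ => JB_eq_prefactor_mul σ hδ1 ht (hLam_neg_one ht h) hφ.mem_Ioo
  refine ⟨fun t ht Lam h φ hφ => ⟨rayIntegrable_integrandJB σ hδ1 ht (hLam_neg_one ht h) hφ,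
      rayIntegrable_integrandTilde σ hδ1 ht (hLam_neg_one ht h) hφ⟩,
    fun w hw => rayIntegrable_fresnelIntegrand hw, hJB,
    fun t ht Lam h => omega_nonneg hδ1 ht (hLam ht h), fun η hη => ?_,
    ⟨√Real.pi / 2, fun t ht Lam h => norm_fresnel_le (omega_nonneg hδ1 ht (hLam ht h))⟩,
    1, 1, one_pos, fun t _ Lam _ hW => norm_exp_mul_fresnel_sub_le (one_pos.trans_le hW),
    fun η hη => ?_⟩
  · obtain ⟨T, hT1, hT⟩ := exists_forall_JBtilde_eq_leadingTerm_mul σ hδ0 hδ1 hη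
    refine ⟨T, hT1, fun t ht Lam h φ hφ => ?_⟩
    obtain ⟨e, he, heq⟩ := hT t ht Lam (hLam (hT1.trans_le ht) h) φ hφ
    exact ⟨e, he, heq, by rw [hJB t (hT1.trans_le ht) Lam h φ hφ, heq]⟩
  · obtain ⟨T, hT1, hT⟩ := exists_forall_JBtilde_eq_leadingTerm_mul σ hδ0 hδ1 hη
    refine ⟨T, hT1, fun t ht Lam h hW φ hφ => ?_⟩
    obtain ⟨e, he, heq⟩ := hT t ht Lam (hLam (hT1.trans_le ht) h) φ hφ
    refine ⟨_, e, norm_exp_mul_fresnel_sub_le (one_pos.trans_le hW), he, ?_⟩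
    rw [heq, leadingTerm]
    ring

theorem theorem1 (δ σ : ℝ) (hδ0 : 0 < δ) (hδ1 : δ < 1) (hσ0 : 1 / 2 ≤ σ) (hσ1 : σ < 1) :
    -- all the integrals converge absolutely
    (∀ t : ℝ, 1 < t → ∀ Lam : ℝ, lamC δ t * (1 + Lam) ∈ lamRange δ t →
      ∀ φ : ℝ, AdmissibleAngle (lamC δ t * (1 + Lam)) φ →
        RayIntegrable (integrandJB σ t (lamC δ t * (1 + Lam)))
          ((1 - t ^ (δ - 1) : ℝ) : ℂ) φ ∧
        RayIntegrable (integrandTilde δ σ t Lam) 0 φ) ∧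
    (∀ w : ℝ, 0 ≤ w → RayIntegrable fresnelIntegrand (w : ℂ) (Real.pi / 4)) ∧
    -- the exact relation between the integral and the reduced integral
    (∀ t : ℝ, 1 < t → ∀ Lam : ℝ, lamC δ t * (1 + Lam) ∈ lamRange δ t →
      ∀ φ : ℝ, AdmissibleAngle (lamC δ t * (1 + Lam)) φ →
        JB δ σ t (lamC δ t * (1 + Lam)) φ = prefactor δ σ t Lam * JBtilde δ σ t Lam φ) ∧
    -- nonnegativity of `ω`
    (∀ t : ℝ, 1 < t → ∀ Lam : ℝ, lamC δ t * (1 + Lam) ∈ lamRange δ t → 0 ≤ omega δ t Lam) ∧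
    -- leading-order asymptotics, uniformly over the whole range
    (∀ η : ℝ, 0 < η → ∃ T : ℝ, 1 < T ∧ ∀ t : ℝ, T ≤ t →
      ∀ Lam : ℝ, lamC δ t * (1 + Lam) ∈ lamRange δ t →
      ∀ φ : ℝ, AdmissibleAngle (lamC δ t * (1 + Lam)) φ →
        ∃ e : ℂ, ‖e‖ ≤ η ∧
          JBtilde δ σ t Lam φ = leadingTerm δ t Lam * (1 + e) ∧
          JB δ σ t (lamC δ t * (1 + Lam)) φ =
            prefactor δ σ t Lam * (leadingTerm δ t Lam * (1 + e))) ∧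
    -- the Fresnel integral is bounded, uniformly in `t` and `Λ` (in particular when `ω = O(1)`)
    (∃ C : ℝ, ∀ t : ℝ, 1 < t → ∀ Lam : ℝ, lamC δ t * (1 + Lam) ∈ lamRange δ t →
      ‖fresnel (omega δ t Lam)‖ ≤ C) ∧
    -- the regime of large `ω`: the Fresnel factor and the resulting form of the asymptotics
    (∃ C W : ℝ, 0 < W ∧
      (∀ t : ℝ, 1 < t → ∀ Lam : ℝ, lamC δ t * (1 + Lam) ∈ lamRange δ t →
        W ≤ omega δ t Lam →
          ‖Complex.exp (-Complex.I * (omega δ t Lam : ℂ) ^ 2) * fresnel (omega δ t Lam)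
              - (-1 / (2 * Complex.I * (omega δ t Lam : ℂ)))‖ ≤ C / omega δ t Lam ^ 3) ∧
      (∀ η : ℝ, 0 < η → ∃ T : ℝ, 1 < T ∧ ∀ t : ℝ, T ≤ t →
        ∀ Lam : ℝ, lamC δ t * (1 + Lam) ∈ lamRange δ t → W ≤ omega δ t Lam →
        ∀ φ : ℝ, AdmissibleAngle (lamC δ t * (1 + Lam)) φ →
          ∃ r e : ℂ, ‖r‖ ≤ C / omega δ t Lam ^ 3 ∧ ‖e‖ ≤ η ∧
            JBtilde δ σ t Lam φ =
              (Real.sqrt (2 / (lamC δ t * t)) : ℂ) *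
                (-1 / (2 * Complex.I * (omega δ t Lam : ℂ)) + r) * (1 + e))) :=
  theorem1_general σ hδ0 hδ1 (R := lamRange δ) fun _ => Set.Icc_subset_Ici_self
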